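/- Let $n\in\mathbb N$, let $\Omega=\begin{pmatrix}0&-I_n\\ I_n&0\end{pmatrix}$, and let $H:[0,\infty)\to M_{2n}(\mathbb C)$ be a continuous family of complex symmetric matrices (the Hamiltonian is $\frac12 z\cdot H(t)z$, $z=(p,q)$), with entrywise real and imaginary parts $\operatorname{Re}H$, $\operatorname{Im}H$. For $\hbar>0$ consider on $\mathbb R^{2n}$ the Wigner–von Neumann equation $$\hbar\,\partial_tW(t,z)=-\Big(-\tfrac{\hbar^2}{4}\Delta_{\operatorname{Im}H}-\hbar\, z\cdot \operatorname{Re}H\,\Omega\nabla- z\cdot \operatorname{Im}H z\Big)W(t,z),\qquad \Delta_{\operatorname{Im}H}=-\nabla\cdot\Omega^T\operatorname{Im}H\,\Omega\nabla. \tag{1}$$ For a $4n\times4n$ matrix in $2n\times 2n$ blocks put $\Phi_*G=(\Phi_{11}G+\Phi_{12})(\Phi_{21}G+\Phi_{22})^{-1}$. Let $G\in M_{2n}(\mathbb R)$ be symmetric, positive definite and symplectic. Then there is a $T>0$, depending only on $H$ and $G$, such that the following holds on $[0,T)$. The linear system $$\dot\Phi=\begin{pmatrix}0&-I\\ I&0\end{pmatrix}\begin{pmatrix}-\Omega^T\operatorname{Im}H\,\Omega&\Omega\operatorname{Re}H\\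 -\operatorname{Re}H\,\Omega&\operatorname{Im}H\end{pmatrix}\Phi,\qquad \Phi(0)=I,$$ has a solution; for it $\Phi_{21}G+\Phi_{22}$ is invertible and $G(t):=\Phi(t)_*G$ is symmetric positive definite. For all $\hbar>0$ and $Z_0\in\mathbb R^{2n}$ there are solutions $Z(t)\in\mathbb R^{2n}$ and $\beta(t)\in\mathbb R$ of $$\dot Z=\Omega\operatorname{Re}H\,Z+G(t)^{-1}\operatorname{Im}H\,Z,\quad Z(0)=Z_0,\qquad \dot\beta=-\tfrac1\hbar Z\cdot\operatorname{Im}H\,Z-\tfrac12\operatorname{tr}[\operatorname{Im}H\,\Omega\, G(t)\,\Omega^T],\quad \beta(0)=0,$$ and for any such $\Phi$, $Z$, $\beta$ the function $$W(t,z)=\frac{e^{-\beta(t)}}{(\pi\hbar)^n}\,e^{-\frac1\hbar(z-Z(t))\cdot[\Phi(t)_*G](z-Z(t))}$$ is a classical solution of (1) (with one-sided time derivative at $t=0$) with initial value $W(0,z)=(\pi\hbar)^{-n}e^{-\frac1\hbar(z-Z_0)\cdot G(z-Z_0)}$. It belongs to $C([0,T);L^2(\mathbb R^{2n}))$ and is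 the unique real-valued solution of (1) with this initial value in that class, where solutions are understood weakly: for every $\varphi\in C_c^\infty(\mathbb R^{2n})$, $t\mapsto\int W(t,z)\varphi(z)\,dz$ is differentiable on $[0,T)$ and (1) holds after integration against $\varphi$, all $z$-derivatives being moved to $\varphi$. -/

import Mathlib

open MeasureTheory Filter Topology Set
open scoped Matrix ContDiff

noncomputable section

namespace WignerGaussian

/-- Index set of phase-space coordinates `z = (p, q)`: momenta on the left, positions on the
right. -/
abbrev Idx (n : ℕ) : Type := Fin n ⊕ Fin n

/-- Phase space `ℝⁿ × ℝⁿ`, with points `z = (p, q)`; its `volume` is Lebesgue measure. -/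
abbrev PhaseSpace (n : ℕ) : Type := Idx n → ℝ

/-- Real matrices acting on phase space. -/
abbrev PhaseMat (n : ℕ) : Type := Matrix (Idx n) (Idx n) ℝ

/-- The symplectic matrix `Ω = (0, -I; I, 0)` on phase space. -/
abbrev Om (n : ℕ) : PhaseMat n := Matrix.J (Fin n) ℝ

/-- The entrywise real part of a complex matrix. -/
def reMat {n : ℕ} (H : Matrix (Idx n) (Idx n) ℂ) : PhaseMat n := H.map Complex.re

/-- The entrywise imaginary part of a complex matrix. -/
def imMat {n : ℕ} (H : Matrix (Idx n) (Idx n) ℂ) : PhaseMat n := H.map Complex.im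

/-- The gradient `∇ f`, as the vector of partial derivatives. -/
def grad {n : ℕ} (f : PhaseSpace n → ℝ) (z : PhaseSpace n) : PhaseSpace n :=
  fun i => fderiv ℝ f z (Pi.single i 1)

/-- The divergence `∇ · F` of a vector field. -/
def diverg {n : ℕ} (F : PhaseSpace n → PhaseSpace n) (z : PhaseSpace n) : ℝ :=
  ∑ i, fderiv ℝ (fun y => F y i) z (Pi.single i 1)

/-- `Δ_K f = - ∇ · (Ωᵀ K Ω ∇ f)`. -/
def lapl {n : ℕ} (K : PhaseMat n) (f : PhaseSpace n → ℝ) (z : PhaseSpace n) : ℝ :=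
  -diverg (fun y => ((Om n)ᵀ * K * Om n) *ᵥ grad f y) z

/-- The right-hand side of the quadratic Wigner–von Neumann equation, with `R = Re H`, `K = Im H`:
`-( -(ħ²/4) Δ_K - ħ z · R Ω ∇ - z · K z ) f`. -/
def wignerOp {n : ℕ} (hbar : ℝ) (H : Matrix (Idx n) (Idx n) ℂ) (f : PhaseSpace n → ℝ)
    (z : PhaseSpace n) : ℝ :=
  -(-(hbar ^ 2 / 4) * lapl (imMat H) f z
    - hbar * (z ⬝ᵥ ((reMat H * Om n) *ᵥ grad f z))
    - (z ⬝ᵥ (imMat H *ᵥ z)) * f z)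

/-- The formal transpose of `wignerOp` (for symmetric `H`), obtained by moving all derivatives to
the test function: `Δ_K` is formally symmetric, and the transpose of `z · A ∇` is
`φ ↦ - ∇ · (φ Aᵀ z)`. -/
def wignerOpTranspose {n : ℕ} (hbar : ℝ) (H : Matrix (Idx n) (Idx n) ℂ) (φ : PhaseSpace n → ℝ)
    (z : PhaseSpace n) : ℝ :=
  -(-(hbar ^ 2 / 4) * lapl (imMat H) φ z
    + hbar * diverg (fun y => φ y • (y ᵥ* (reMat H * Om n))) z
    - (z ⬝ᵥ (imMat H *ᵥ z)) * φ z)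

/-- `W` is a classical solution of `ħ ∂ₜ W = wignerOp W` on `[0, T)`: it is `C²` in `z`, and
differentiable in `t` (one-sidedly at `t = 0`), and the equation holds at every point. -/
def IsClassicalSolution {n : ℕ} (hbar : ℝ) (H : ℝ → Matrix (Idx n) (Idx n) ℂ) (T : ℝ)
    (W : ℝ → PhaseSpace n → ℝ) : Prop :=
  ∀ t ∈ Ico 0 T, ContDiff ℝ 2 (W t) ∧
    ∀ z, ∃ d : ℝ, HasDerivWithinAt (fun s => W s z) d (Ico 0 T) t ∧
      hbar * d = wignerOp hbar (H t) (W t) z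

/-- `W` is a weak solution of `ħ ∂ₜ W = wignerOp W` on `[0, T)` in the class
`C([0, T); L²(ℝ²ⁿ))`: the equation holds after integration against every test function. -/
structure IsL2Solution {n : ℕ} (hbar : ℝ) (H : ℝ → Matrix (Idx n) (Idx n) ℂ) (T : ℝ)
    (W : ℝ → PhaseSpace n → ℝ) : Prop where
  memLp : ∀ t ∈ Ico 0 T, MemLp (W t) 2 volume
  continuous : ∀ t ∈ Ico 0 T,
    Tendsto (fun s => eLpNorm (W s - W t) 2 volume) (𝓝[Ico 0 T] t) (𝓝 0)
  weak : ∀ φ : PhaseSpace n → ℝ, ContDiff ℝ ∞ φ → HasCompactSupport φ → ∀ t ∈ Ico 0 T,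
    HasDerivWithinAt (fun s => hbar * ∫ z, W s z * φ z)
      (∫ z, W t z * wignerOpTranspose hbar (H t) φ z) (Ico 0 T) t

/-- The symmetric matrix of the Hamiltonian on the doubled phase space:
`(-Ωᵀ Im H Ω, Ω Re H; -Re H Ω, Im H)`. -/
def doubledHam {n : ℕ} (H : Matrix (Idx n) (Idx n) ℂ) :
    Matrix (Idx n ⊕ Idx n) (Idx n ⊕ Idx n) ℝ :=
  Matrix.fromBlocks (-((Om n)ᵀ * imMat H * Om n)) (Om n * reMat H)
    (-(reMat H * Om n)) (imMat H)

/-- `Φ` solves `Φ' = (0, -I; I, 0) (-Ωᵀ Im H Ω, Ω Re H; -Re H Ω, Im H) Φ` on `[0, T)`, with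
`Φ(0) = I`. -/
def IsDoubledFlow {n : ℕ} (H : ℝ → Matrix (Idx n) (Idx n) ℂ) (T : ℝ)
    (Φ : ℝ → Matrix (Idx n ⊕ Idx n) (Idx n ⊕ Idx n) ℝ) : Prop :=
  Φ 0 = 1 ∧ ∀ t ∈ Ico 0 T, ∀ i j,
    HasDerivWithinAt (fun s => Φ s i j)
      ((Matrix.J (Idx n) ℝ * doubledHam (H t) * Φ t) i j) (Ico 0 T) t

/-- The denominator `Φ₂₁ G + Φ₂₂` of the fractional linear action. -/
def actDenom {n : ℕ} (Φ : Matrix (Idx n ⊕ Idx n) (Idx n ⊕ Idx n) ℝ) (G : PhaseMat n) :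
    PhaseMat n :=
  Φ.toBlocks₂₁ * G + Φ.toBlocks₂₂

/-- The fractional linear action `Φ_* G = (Φ₁₁ G + Φ₁₂) (Φ₂₁ G + Φ₂₂)⁻¹`. -/
def act {n : ℕ} (Φ : Matrix (Idx n ⊕ Idx n) (Idx n ⊕ Idx n) ℝ) (G : PhaseMat n) : PhaseMat n :=
  (Φ.toBlocks₁₁ * G + Φ.toBlocks₁₂) * (actDenom Φ G)⁻¹

/-- `Z` solves `Z' = Ω Re H Z + G(t)⁻¹ Im H Z` on `[0, T)`, with `Z(0) = Z₀`. -/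
def IsCentre {n : ℕ} (H : ℝ → Matrix (Idx n) (Idx n) ℂ) (T : ℝ) (G : ℝ → PhaseMat n)
    (Z₀ : PhaseSpace n) (Z : ℝ → PhaseSpace n) : Prop :=
  Z 0 = Z₀ ∧ ∀ t ∈ Ico 0 T,
    HasDerivWithinAt Z ((Om n * reMat (H t)) *ᵥ Z t + ((G t)⁻¹ * imMat (H t)) *ᵥ Z t) (Ico 0 T) t

/-- `β` solves `β' = -(1/ħ) Z · Im H Z - (1/2) tr (Im H Ω G Ωᵀ)` on `[0, T)`, with `β(0) = 0`. -/
def IsNormalisation {n : ℕ} (hbar : ℝ) (H : ℝ → Matrix (Idx n) (Idx n) ℂ) (T : ℝ)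
    (G : ℝ → PhaseMat n) (Z : ℝ → PhaseSpace n) (β : ℝ → ℝ) : Prop :=
  β 0 = 0 ∧ ∀ t ∈ Ico 0 T,
    HasDerivWithinAt β
      (-(1 / hbar) * (Z t ⬝ᵥ (imMat (H t) *ᵥ Z t))
        - 1 / 2 * (imMat (H t) * Om n * G t * (Om n)ᵀ).trace) (Ico 0 T) t

/-- The Gaussian `e^{-b} (πħ)^{-n} exp(-(1/ħ) (z - Z) · G (z - Z))`. -/
def gaussian {n : ℕ} (hbar b : ℝ) (Z : PhaseSpace n) (G : PhaseMat n) (z : PhaseSpace n) : ℝ :=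
  Real.exp (-b) / (Real.pi * hbar) ^ n * Real.exp (-(1 / hbar) * ((z - Z) ⬝ᵥ (G *ᵥ (z - Z))))

end WignerGaussian

end

/-!
A Gaussian `exp (-(z - Z) · G (z - Z) / ħ - β)` solves the Wigner–von Neumann equation when its
parameters solve ordinary differential equations: comparing powers of `z - Z` gives a matrix Riccati
equation for `G`, a linear equation for `Z` and an integral for `β` (`wignerOp_gaussian`).

The Riccati equation is linearised by the doubled flow: with `P = Φ₁₁ G + Φ₁₂` and `Q = Φ₂₁ G +
Φ₂₂`, the quotient `P Q⁻¹` satisfies it (`IsDoubledFlow.hasDeriv_act`), and it is symmetric because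
`Pᵀ Q - Qᵀ P` is conserved (`IsDoubledFlow.isotropic`). By Grönwall's inequality the doubled flow
stays near the identity for a time governed by `G` and a bound on `H`, so that `Q` is invertible and
`P Q⁻¹` is bounded below (`exists_flow_time`). The centre is explicit, since `Pᵀ Z` is conserved
too. On compact time intervals the moving Gaussian, its gradient and its time derivative are
dominated by one fixed Gaussian (`IsGaussianPath.exists_dominated`); differentiation under the
integral sign and integration by parts then turn the classical solution into a weak one in
`C([0, T); L²)`.

Uniqueness is by duality. The transposed operator is the operator of the Hamiltonian with reversed
real part (`wignerOpTranspose_eq`), so the adjoint equation, run backwards from a time `t₁`, is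
again solved by moving Gaussians. A difference of two solutions vanishes at time `0`, and its
pairing with such a backward Gaussian is conserved: inserting a cutoff at scale `r⁻¹` makes the
Gaussian a test function and costs an error of order `r` (`abs_cutoffError_le`). Hence the
difference at time `t₁` is orthogonal to every translate of the standard Gaussian
(`IsL2Solution.integral_mul_gaussian_eq_zero`), and these are total in `L²` by uniqueness of the
two-sided Laplace transform (`ae_eq_zero_of_integral_mul_gaussian`). The time interval is chosen so
that it serves both `G` and the standard Gaussians of all the adjoint problems, whose Hamiltonians
obey the same bound as `H`.
-/

noncomputable section

namespace WignerGaussian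

/-! ### Linear systems of ordinary differential equations -/

theorem norm_mulVec_le {ι : Type*} [Fintype ι] {A : Matrix ι ι ℝ} {C : ℝ} (hC : 0 ≤ C)
    (hA : ∀ i, ∑ j, |A i j| ≤ C) (x : ι → ℝ) : ‖A *ᵥ x‖ ≤ C * ‖x‖ := by
  refine (pi_norm_le_iff_of_nonneg (by positivity)).2 fun i => ?_
  calc ‖(A *ᵥ x) i‖ ≤ ∑ j, ‖A i j * x j‖ := norm_sum_le _ _
    _ ≤ ∑ j, |A i j| * ‖x‖ := by
        refine Finset.sum_le_sum fun j _ => ?_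
        rw [norm_mul, Real.norm_eq_abs]
        gcongr
        exact norm_le_pi_norm x j
    _ = (∑ j, |A i j|) * ‖x‖ := by rw [Finset.sum_mul]
    _ ≤ C * ‖x‖ := by gcongr; exact hA i

/-- Existence for a linear system on a time interval whose length depends only on a bound for the
coefficients. -/
theorem exists_linear_ode_solution {ι : Type*} [Fintype ι] {A : ℝ → Matrix ι ι ℝ} {δ C : ℝ}
    (hδ : 0 ≤ δ) (hC : 0 ≤ C) (hA : ContinuousOn A (Icc 0 δ))
    (hbound : ∀ t ∈ Icc 0 δ, ∀ i, ∑ j, |A t i j| ≤ C) (hCδ : 2 * C * δ ≤ 1) (x₀ : ι → ℝ) :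
    ∃ x : ℝ → ι → ℝ, x 0 = x₀ ∧
      ∀ t ∈ Icc 0 δ, HasDerivWithinAt x (A t *ᵥ x t) (Icc 0 δ) t := by
  have key : IsPicardLindelof (fun t x => A t *ᵥ x) (⟨0, le_rfl, hδ⟩ : Icc 0 δ) x₀
      (‖x₀‖₊ + 1) 0 (C.toNNReal * (2 * (‖x₀‖₊ + 1))) C.toNNReal := by
    refine ⟨fun t ht => ?_, fun x _ => ?_, fun t ht x hx => ?_, ?_⟩
    · refine LipschitzOnWith.of_dist_le_mul fun x _ y _ => ?_
      rw [dist_eq_norm, dist_eq_norm, ← Matrix.mulVec_sub, Real.coe_toNNReal _ hC]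
      exact norm_mulVec_le hC (hbound t ht) _
    · exact (Continuous.matrix_mulVec continuous_id continuous_const).comp_continuousOn hA
    · refine (norm_mulVec_le hC (hbound t ht) x).trans ?_
      have h1 : ‖x‖ ≤ 2 * (‖x₀‖ + 1) := by
        have := norm_le_of_mem_closedBall hx
        push_cast [coe_nnnorm] at this
        linarith [norm_nonneg x₀]
      push_cast [Real.coe_toNNReal _ hC, coe_nnnorm]
      gcongr
    · push_cast [Real.coe_toNNReal _ hC, coe_nnnorm]
      rw [sub_zero, zero_sub, neg_zero, sub_zero, max_eq_left hδ]
      nlinarith [norm_nonneg x₀]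
  exact key.exists_eq_forall_mem_Icc_hasDerivWithinAt₀

/-- Grönwall bound on the distance of a solution of a linear system from its initial value. -/
theorem linear_ode_norm_sub_le {ι : Type*} [Fintype ι] {A : ℝ → Matrix ι ι ℝ} {T C : ℝ}
    (hC : 0 ≤ C) (hbound : ∀ t ∈ Ico 0 T, ∀ i, ∑ j, |A t i j| ≤ C) {x : ℝ → ι → ℝ}
    (hx : ∀ t ∈ Ico 0 T, HasDerivWithinAt x (A t *ᵥ x t) (Ico 0 T) t) {t : ℝ}
    (ht : t ∈ Ico 0 T) : ‖x t - x 0‖ ≤ gronwallBound 0 C (C * ‖x 0‖) t := by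
  have hsub : Icc 0 t ⊆ Ico 0 T := fun s hs => ⟨hs.1, hs.2.trans_lt ht.2⟩
  have := norm_le_gronwallBound_of_norm_deriv_right_le (f := fun s => x s - x 0)
    (f' := fun s => A s *ᵥ x s) (δ := 0) (K := C) (ε := C * ‖x 0‖) (a := 0) (b := t)
    (fun s hs => ((hx s (hsub hs)).continuousWithinAt.mono hsub).sub continuousWithinAt_const)
    (fun s hs => ?_) (by simp) (fun s hs => ?_) t ⟨ht.1, le_rfl⟩
  · simpa using this
  · have hs' := hsub (Ico_subset_Icc_self hs)
    refine (HasDerivWithinAt.sub_const (x 0) (hx s hs')).mono_of_mem_nhdsWithin ?_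
    have : Ico s T ∈ 𝓝[≥] s := Ico_mem_nhdsGE hs'.2
    exact mem_of_superset this (Ico_subset_Ico_left hs'.1)
  · refine (norm_mulVec_le hC (hbound s (hsub (Ico_subset_Icc_self hs))) _).trans ?_
    have : ‖x s‖ ≤ ‖x s - x 0‖ + ‖x 0‖ := by
      simpa using norm_add_le (x s - x 0) (x 0)
    rw [← mul_add]
    gcongr

/-! ### Entrywise derivatives of matrices -/

theorem hasDerivWithinAt_matrix_mul {l m k : Type*} [Fintype m] {A : ℝ → Matrix l m ℝ}
    {A' : Matrix l m ℝ} {B : ℝ → Matrix m k ℝ} {B' : Matrix m k ℝ} {S : Set ℝ} {t : ℝ}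
    (hA : ∀ i j, HasDerivWithinAt (fun s => A s i j) (A' i j) S t)
    (hB : ∀ i j, HasDerivWithinAt (fun s => B s i j) (B' i j) S t) (i : l) (j : k) :
    HasDerivWithinAt (fun s => (A s * B s) i j) ((A' * B t + A t * B') i j) S t := by
  simp only [Matrix.mul_apply, Matrix.add_apply, ← Finset.sum_add_distrib]
  exact HasDerivWithinAt.fun_sum fun k _ => (hA i k).mul (hB k j)

theorem hasDerivWithinAt_matrix_transpose {l m : Type*} {A : ℝ → Matrix l m ℝ}
    {A' : Matrix l m ℝ} {S : Set ℝ} {t : ℝ}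
    (hA : ∀ i j, HasDerivWithinAt (fun s => A s i j) (A' i j) S t) (i : m) (j : l) :
    HasDerivWithinAt (fun s => (A s)ᵀ i j) (A'ᵀ i j) S t := hA j i

theorem continuousWithinAt_matrix {X l m : Type*} [TopologicalSpace X] {A : X → Matrix l m ℝ}
    {S : Set X} {t : X}
    (hA : ∀ i j, ContinuousWithinAt (fun s => A s i j) S t) : ContinuousWithinAt A S t :=
  continuousWithinAt_pi.2 fun i => continuousWithinAt_pi.2 fun j => hA i j

theorem continuousAt_matrix_inv {ι : Type*} [Fintype ι] [DecidableEq ι] {M : Matrix ι ι ℝ}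
    (hM : IsUnit M) : ContinuousAt (fun N : Matrix ι ι ℝ => N⁻¹) M := by
  have hdet : M.det ≠ 0 := ((Matrix.isUnit_iff_isUnit_det M).1 hM).ne_zero
  have : (fun N : Matrix ι ι ℝ => N⁻¹) = fun N => N.det⁻¹ • N.adjugate := by
    funext N
    rw [Matrix.inv_def, Ring.inverse_eq_inv']
  rw [this]
  exact (continuous_id.matrix_det.continuousAt.inv₀ hdet).smul
    continuous_id.matrix_adjugate.continuousAt

/-- Entrywise derivative of the inverse. No norm on matrices is involved; invertibility is assumed
on all of `S`. -/
theorem hasDerivWithinAt_matrix_inv {ι : Type*} [Fintype ι] [DecidableEq ι]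
    {Q : ℝ → Matrix ι ι ℝ} {Q' : Matrix ι ι ℝ} {S : Set ℝ} {t : ℝ} (ht : t ∈ S)
    (hu : ∀ s ∈ S, IsUnit (Q s))
    (hQ : ∀ i j, HasDerivWithinAt (fun s => Q s i j) (Q' i j) S t) (i j : ι) :
    HasDerivWithinAt (fun s => (Q s)⁻¹ i j) ((-((Q t)⁻¹ * Q' * (Q t)⁻¹)) i j) S t := by
  have hcont : ContinuousWithinAt (fun s => (Q s)⁻¹) S t :=
    (continuousAt_matrix_inv (hu t ht)).comp_continuousWithinAt
      (continuousWithinAt_matrix fun i j => (hQ i j).continuousWithinAt)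
  have hQs := fun i j => hasDerivWithinAt_iff_tendsto_slope.1 (hQ i j)
  rw [hasDerivWithinAt_iff_tendsto_slope]
  have hlim : Tendsto (fun s => -((Q s)⁻¹ * Matrix.of (fun i j => slope (fun s => Q s i j) t s)
      * (Q t)⁻¹) i j) (𝓝[S \ {t}] t) (𝓝 ((-((Q t)⁻¹ * Q' * (Q t)⁻¹)) i j)) := by
    have h1 : Tendsto (fun s => (Q s)⁻¹) (𝓝[S \ {t}] t) (𝓝 (Q t)⁻¹) :=
      hcont.tendsto.mono_left (nhdsWithin_mono _ sdiff_subset)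
    have h2 : Tendsto (fun s => Matrix.of (fun i j => slope (fun s => Q s i j) t s))
        (𝓝[S \ {t}] t) (𝓝 Q') :=
      tendsto_pi_nhds.2 fun i => tendsto_pi_nhds.2 fun j => hQs i j
    have h3 := (h1.mul h2).mul (tendsto_const_nhds (x := (Q t)⁻¹))
    exact ((tendsto_pi_nhds.1 ((tendsto_pi_nhds.1 h3) i)) j).neg
  refine hlim.congr' ?_
  filter_upwards [self_mem_nhdsWithin] with s hs
  have hus := (Matrix.isUnit_iff_isUnit_det _).1 (hu s hs.1)
  have hut := (Matrix.isUnit_iff_isUnit_det _).1 (hu t ht)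
  have e1 : Matrix.of (fun i j => slope (fun s => Q s i j) t s) = (s - t)⁻¹ • (Q s - Q t) := by
    ext i j
    simp [slope]
  -- the resolvent identity `Q_s⁻¹ - Q_t⁻¹ = -Q_s⁻¹ (Q_s - Q_t) Q_t⁻¹`
  have e2 : (Q s)⁻¹ * (Q s - Q t) * (Q t)⁻¹ = (Q t)⁻¹ - (Q s)⁻¹ := by
    rw [mul_sub, sub_mul, Matrix.nonsing_inv_mul _ hus, one_mul, mul_assoc,
      Matrix.mul_nonsing_inv _ hut, mul_one]
  rw [e1, Matrix.mul_smul, Matrix.smul_mul, e2]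
  simp only [slope, Matrix.smul_apply, Matrix.sub_apply, smul_eq_mul, vsub_eq_sub]
  ring

/-! ### The doubled flow -/

theorem continuous_reMat {n : ℕ} : Continuous (reMat (n := n)) :=
  continuous_id.matrix_map Complex.continuous_re

theorem continuous_imMat {n : ℕ} : Continuous (imMat (n := n)) :=
  continuous_id.matrix_map Complex.continuous_im

theorem continuous_doubledHam {n : ℕ} : Continuous (doubledHam (n := n)) :=
  Continuous.matrix_fromBlocks
    ((continuous_const.matrix_mul continuous_imMat).matrix_mul continuous_const).neg
    (continuous_const.matrix_mul continuous_reMat)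
    (continuous_reMat.matrix_mul continuous_const).neg continuous_imMat

theorem reMat_isSymm {n : ℕ} {H : Matrix (Idx n) (Idx n) ℂ} (h : H.IsSymm) :
    (reMat H)ᵀ = reMat H := h.map _

theorem imMat_isSymm {n : ℕ} {H : Matrix (Idx n) (Idx n) ℂ} (h : H.IsSymm) :
    (imMat H)ᵀ = imMat H := h.map _

/-- The coefficients of the doubled system are bounded in terms of the entries of `H`. -/
theorem exists_doubledHam_bound (n : ℕ) (B : ℝ) : ∃ C : ℝ, 0 < C ∧
    ∀ M : Matrix (Idx n) (Idx n) ℂ, (∀ i j, ‖M i j‖ ≤ B) →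
      ∀ i, ∑ j, |(Matrix.J (Idx n) ℝ * doubledHam M) i j| ≤ C := by
  have hK : IsCompact {M : Matrix (Idx n) (Idx n) ℂ | ∀ i j, ‖M i j‖ ≤ B} := by
    have := isCompact_univ_pi fun _ : Idx n => isCompact_univ_pi fun _ : Idx n =>
      isCompact_closedBall (0 : ℂ) B
    have e : {M : Matrix (Idx n) (Idx n) ℂ | ∀ i j, ‖M i j‖ ≤ B} =
        univ.pi fun _ : Idx n => univ.pi fun _ : Idx n => Metric.closedBall (0 : ℂ) B :=
      Set.ext fun M => ⟨fun h i _ j _ => mem_closedBall_zero_iff.2 (h i j),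
        fun h i j => mem_closedBall_zero_iff.1 (h i trivial j trivial)⟩
    rw [e]
    exact this
  have hcont : Continuous fun M : Matrix (Idx n) (Idx n) ℂ =>
      ∑ i, ∑ j, |(Matrix.J (Idx n) ℝ * doubledHam M) i j| := by
    have := (continuous_const (y := Matrix.J (Idx n) ℝ)).matrix_mul (continuous_doubledHam (n := n))
    exact continuous_finsetSum _ fun i _ => continuous_finsetSum _ fun j _ =>
      (this.matrix_elem i j).abs
  obtain ⟨C, hC⟩ := hK.exists_bound_of_continuousOn hcont.continuousOn
  refine ⟨max C 1, by positivity, fun M hM i => ?_⟩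
  have h1 := hC M hM
  rw [Real.norm_eq_abs] at h1
  refine le_trans ?_ (le_max_left _ _)
  refine le_trans ?_ ((le_abs_self _).trans h1)
  exact Finset.single_le_sum (f := fun i => ∑ j, |(Matrix.J (Idx n) ℝ * doubledHam M) i j|)
    (fun i _ => Finset.sum_nonneg fun j _ => abs_nonneg _) (Finset.mem_univ i)

/-- A positive definite matrix is bounded below by a multiple of the squared norm. -/
theorem exists_lower_bound {n : ℕ} {G : PhaseMat n} (hG : G.PosDef) :
    ∃ c : ℝ, 0 < c ∧ ∀ z : PhaseSpace n, c * ‖z‖ ^ 2 ≤ z ⬝ᵥ (G *ᵥ z) := by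
  have hpos : ∀ z : PhaseSpace n, z ≠ 0 → 0 < z ⬝ᵥ (G *ᵥ z) := fun z hz => by
    simpa using hG.dotProduct_mulVec_pos hz
  have hcont : Continuous fun z : PhaseSpace n => z ⬝ᵥ (G *ᵥ z) :=
    continuous_id.dotProduct (continuous_const.matrix_mulVec continuous_id)
  rcases (Metric.sphere (0 : PhaseSpace n) 1).eq_empty_or_nonempty with he | hne
  · refine ⟨1, one_pos, fun z => ?_⟩
    by_cases hz : z = 0
    · simp [hz]
    · have : ‖z‖⁻¹ • z ∈ Metric.sphere (0 : PhaseSpace n) 1 := by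
        simp [norm_smul, norm_ne_zero_iff.2 hz]
      simp [he] at this
  · obtain ⟨w, hw, hmin⟩ := (isCompact_sphere (0 : PhaseSpace n) 1).exists_isMinOn hne
      hcont.continuousOn
    have hw0 : w ≠ 0 := by
      rintro rfl
      simp at hw
    refine ⟨_, hpos w hw0, fun z => ?_⟩
    by_cases hz : z = 0
    · simp [hz]
    · have hn : ‖z‖ ≠ 0 := norm_ne_zero_iff.2 hz
      have : ‖z‖⁻¹ • z ∈ Metric.sphere (0 : PhaseSpace n) 1 := by
        simp [norm_smul, hn]
      have h1 : w ⬝ᵥ (G *ᵥ w) ≤ (‖z‖⁻¹ • z) ⬝ᵥ (G *ᵥ (‖z‖⁻¹ • z)) := hmin this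
      rw [Matrix.mulVec_smul, smul_dotProduct, dotProduct_smul, smul_eq_mul, smul_eq_mul] at h1
      calc w ⬝ᵥ (G *ᵥ w) * ‖z‖ ^ 2 ≤ (‖z‖⁻¹ * (‖z‖⁻¹ * (z ⬝ᵥ (G *ᵥ z)))) * ‖z‖ ^ 2 := by gcongr
        _ = z ⬝ᵥ (G *ᵥ z) := by field_simp

/-- Entrywise bounds control bilinear forms in the supremum norm. -/
theorem abs_dotProduct_mulVec_le {ι : Type*} [Fintype ι] {M : Matrix ι ι ℝ} {ε : ℝ}
    (hM : ∀ i j, |M i j| ≤ ε) (u v : ι → ℝ) :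
    |u ⬝ᵥ (M *ᵥ v)| ≤ (Fintype.card ι : ℝ) ^ 2 * ε * (‖u‖ * ‖v‖) := by
  have : ∀ i j, |u i * (M i j * v j)| ≤ ε * (‖u‖ * ‖v‖) := fun i j => by
    rw [abs_mul, abs_mul]
    have h1 : |u i| ≤ ‖u‖ := norm_le_pi_norm u i
    have h2 : |v j| ≤ ‖v‖ := norm_le_pi_norm v j
    have h3 := hM i j
    have h0 : 0 ≤ ε := (abs_nonneg _).trans h3
    calc |u i| * (|M i j| * |v j|) ≤ ‖u‖ * (ε * ‖v‖) := by gcongr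
      _ = ε * (‖u‖ * ‖v‖) := by ring
  calc |u ⬝ᵥ (M *ᵥ v)| = |∑ i, ∑ j, u i * (M i j * v j)| := by
        simp only [dotProduct, Matrix.mulVec, Finset.mul_sum]
    _ ≤ ∑ i, ∑ j, |u i * (M i j * v j)| :=
        (Finset.abs_sum_le_sum_abs _ _).trans
          (Finset.sum_le_sum fun i _ => Finset.abs_sum_le_sum_abs _ _)
    _ ≤ ∑ i : ι, ∑ j : ι, ε * (‖u‖ * ‖v‖) :=
        Finset.sum_le_sum fun i _ => Finset.sum_le_sum fun j _ => this i j
    _ = _ := by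
        simp only [Finset.sum_const, Finset.card_univ, nsmul_eq_mul]
        ring

theorem actDenom_one {n : ℕ} (G : PhaseMat n) : actDenom 1 G = 1 := by
  rw [actDenom, ← Matrix.fromBlocks_one, Matrix.toBlocks_fromBlocks₂₁,
    Matrix.toBlocks_fromBlocks₂₂, zero_mul, zero_add]

theorem act_one {n : ℕ} (G : PhaseMat n) : act 1 G = G := by
  rw [act, actDenom_one, ← Matrix.fromBlocks_one, Matrix.toBlocks_fromBlocks₁₁,
    Matrix.toBlocks_fromBlocks₁₂, one_mul, add_zero, inv_one, mul_one]

theorem continuous_actDenom {n : ℕ} (G : PhaseMat n) : Continuous fun Φ => actDenom Φ G := by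
  refine Continuous.add (Continuous.matrix_mul ?_ continuous_const) ?_
  · exact continuous_matrix fun i j => continuous_id.matrix_elem _ _
  · exact continuous_matrix fun i j => continuous_id.matrix_elem _ _

theorem continuousAt_act {n : ℕ} (G : PhaseMat n) : ContinuousAt (fun Φ => act Φ G) 1 := by
  refine ContinuousAt.mul (Continuous.continuousAt ?_) ?_
  · refine Continuous.add (Continuous.matrix_mul ?_ continuous_const) ?_
    · exact continuous_matrix fun i j => continuous_id.matrix_elem _ _
    · exact continuous_matrix fun i j => continuous_id.matrix_elem _ _
  · have h := continuousAt_matrix_inv (M := actDenom 1 G) (by rw [actDenom_one]; exact isUnit_one)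
    exact ContinuousAt.comp (f := fun Φ => actDenom Φ G) h (continuous_actDenom G).continuousAt

/-- Near the identity the fractional linear action is defined at `G` and its value is bounded below
as a quadratic form. -/
theorem exists_act_near_one {n : ℕ} {G : PhaseMat n} (hG : G.PosDef) :
    ∃ c > 0, ∃ ε > 0, ∀ Φ : Matrix (Idx n ⊕ Idx n) (Idx n ⊕ Idx n) ℝ,
      (∀ i j, |Φ i j - (1 : Matrix (Idx n ⊕ Idx n) (Idx n ⊕ Idx n) ℝ) i j| < ε) →
      IsUnit (actDenom Φ G) ∧ ∀ z : PhaseSpace n, c * ‖z‖ ^ 2 ≤ z ⬝ᵥ (act Φ G *ᵥ z) := by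
  obtain ⟨c, hc, hcz⟩ := exists_lower_bound hG
  set N : ℝ := (Fintype.card (Idx n) : ℝ) ^ 2 with hN
  have hN0 : 0 ≤ N := by positivity
  set η : ℝ := c / 2 / (N + 1) with hη
  have hη0 : 0 < η := by positivity
  have h1 : ∀ᶠ Φ in 𝓝 (1 : Matrix (Idx n ⊕ Idx n) (Idx n ⊕ Idx n) ℝ), IsUnit (actDenom Φ G) := by
    have hd : ContinuousAt (fun Φ => (actDenom Φ G).det) 1 :=
      (continuous_actDenom G).matrix_det.continuousAt
    have h0 : (actDenom 1 G).det ≠ 0 := by rw [actDenom_one]; simp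
    filter_upwards [hd.eventually_ne h0] with Φ hΦ
    exact (Matrix.isUnit_iff_isUnit_det _).2 (isUnit_iff_ne_zero.2 hΦ)
  have h2 : ∀ i j, ∀ᶠ Φ in 𝓝 (1 : Matrix (Idx n ⊕ Idx n) (Idx n ⊕ Idx n) ℝ),
      |act Φ G i j - G i j| < η := fun i j => by
    have hd : ContinuousAt (fun Φ => act Φ G i j) 1 :=
      (continuous_id.matrix_elem i j).continuousAt.comp (continuousAt_act G)
    have := Metric.tendsto_nhds.1 hd.tendsto η hη0
    simpa only [Real.dist_eq, act_one] using this
  have h3 := h1.and (eventually_all.2 fun i => eventually_all.2 fun j => h2 i j)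
  -- the entrywise boxes form a neighbourhood basis
  have h4 : ∃ ε > 0, ∀ Φ : Matrix (Idx n ⊕ Idx n) (Idx n ⊕ Idx n) ℝ,
      (∀ i j, |Φ i j - (1 : Matrix (Idx n ⊕ Idx n) (Idx n ⊕ Idx n) ℝ) i j| < ε) →
      IsUnit (actDenom Φ G) ∧ ∀ i j, |act Φ G i j - G i j| < η := by
    obtain ⟨ε, hε, h⟩ := Metric.eventually_nhds_iff.1
      (show ∀ᶠ Φ : Idx n ⊕ Idx n → Idx n ⊕ Idx n → ℝ in 𝓝
        (1 : Matrix (Idx n ⊕ Idx n) (Idx n ⊕ Idx n) ℝ), IsUnit (actDenom Φ G) ∧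
        ∀ i j, |act Φ G i j - G i j| < η from h3)
    refine ⟨ε, hε, fun Φ hΦ => h ?_⟩
    exact (dist_pi_lt_iff hε).2 fun i => (dist_pi_lt_iff hε).2 fun j => hΦ i j
  obtain ⟨ε, hε, h⟩ := h4
  refine ⟨c / 2, by positivity, ε, hε, fun Φ hΦ => ⟨(h Φ hΦ).1, fun z => ?_⟩⟩
  have h5 := abs_dotProduct_mulVec_le (M := act Φ G - G) (ε := η)
    (fun i j => ((h Φ hΦ).2 i j).le) z z
  rw [Matrix.sub_mulVec, dotProduct_sub] at h5
  have h6 : N * η ≤ c / 2 := by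
    rw [hη, mul_div_assoc', div_le_iff₀ (by positivity)]
    nlinarith
  have h7 : N * η * (‖z‖ * ‖z‖) ≤ c / 2 * (‖z‖ * ‖z‖) := by gcongr
  have h8 := hcz z
  have h9 := (abs_le.1 h5).1
  nlinarith

theorem IsDoubledFlow.column {n : ℕ} {H : ℝ → Matrix (Idx n) (Idx n) ℂ} {T : ℝ}
    {Φ : ℝ → Matrix (Idx n ⊕ Idx n) (Idx n ⊕ Idx n) ℝ} (hΦ : IsDoubledFlow H T Φ)
    (j : Idx n ⊕ Idx n) {t : ℝ} (ht : t ∈ Ico 0 T) :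
    HasDerivWithinAt (fun s => (Φ s).col j)
      ((Matrix.J (Idx n) ℝ * doubledHam (H t)) *ᵥ (Φ t).col j) (Ico 0 T) t :=
  hasDerivWithinAt_pi.2 fun i => hΦ.2 t ht i j

/-- On a time interval depending only on `G` and on a bound for `H`, the doubled flow exists, stays
in the domain of the fractional linear action at `G`, and the resulting matrices are uniformly
bounded below. -/
theorem exists_flow_time {n : ℕ} {G : PhaseMat n} (hG : G.PosDef) (B : ℝ) :
    ∃ δ > 0, ∃ c > 0, ∀ H : ℝ → Matrix (Idx n) (Idx n) ℂ, ContinuousOn H (Ici 0) →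
      ∀ T ≤ δ, (∀ t ∈ Icc 0 T, ∀ i j, ‖H t i j‖ ≤ B) →
      (∃ Φ, IsDoubledFlow H T Φ) ∧ ∀ Φ, IsDoubledFlow H T Φ → ∀ t ∈ Ico 0 T,
        IsUnit (actDenom (Φ t) G) ∧
          ∀ z : PhaseSpace n, c * ‖z‖ ^ 2 ≤ z ⬝ᵥ (act (Φ t) G *ᵥ z) := by
  obtain ⟨c, hc, ε, hε, hU⟩ := exists_act_near_one hG
  obtain ⟨C, hC, hCb⟩ := exists_doubledHam_bound n B
  have hgr : ∀ᶠ t in 𝓝 (0 : ℝ), gronwallBound 0 C (C * 1) t < ε := by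
    have h := (hasDerivAt_gronwallBound 0 C (C * 1) 0).continuousAt.tendsto
    rw [gronwallBound_x0] at h
    exact h.eventually_lt_const hε
  obtain ⟨δ₁, hδ₁, h₁⟩ := Metric.eventually_nhds_iff.1 hgr
  refine ⟨min δ₁ (1 / (2 * C)), by positivity, c, hc, fun H hH T hT hB => ⟨?_, ?_⟩⟩
  · rcases le_or_gt T 0 with hT0 | hT0
    · exact ⟨fun _ => 1, rfl, fun t ht => absurd (ht.1.trans_lt ht.2) (not_lt.2 hT0)⟩
    have hcoef : ContinuousOn (fun t => Matrix.J (Idx n) ℝ * doubledHam (H t)) (Icc 0 T) :=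
      ((continuous_const (y := Matrix.J (Idx n) ℝ)).matrix_mul
        continuous_doubledHam).comp_continuousOn (hH.mono Icc_subset_Ici_self)
    have hT2 : 2 * C * T ≤ 1 := by
      have := hT.trans (min_le_right _ _)
      rwa [le_div_iff₀ (by positivity), mul_comm] at this
    choose x hx0 hx using fun j : Idx n ⊕ Idx n =>
      exists_linear_ode_solution hT0.le hC.le hcoef (fun t ht => hCb _ (hB t ht)) hT2
        ((1 : Matrix (Idx n ⊕ Idx n) (Idx n ⊕ Idx n) ℝ).col j)
    refine ⟨fun t => Matrix.of fun i j => x j t i, ?_, fun t ht i j => ?_⟩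
    · ext i j
      simp [hx0, Matrix.col_apply]
    · exact (hasDerivWithinAt_pi.1 (hx j t (Ico_subset_Icc_self ht)) i).mono Ico_subset_Icc_self
  · intro Φ hΦ t ht
    refine hU _ fun i j => ?_
    have h := linear_ode_norm_sub_le hC.le
      (fun s hs => hCb _ (hB s (Ico_subset_Icc_self hs))) (fun s hs => hΦ.column j hs) ht
    have hcol : ‖(Φ 0).col j‖ ≤ 1 := by
      rw [hΦ.1]
      refine (pi_norm_le_iff_of_nonneg zero_le_one).2 fun k => ?_
      rw [Matrix.col_apply, Matrix.one_apply]
      split_ifs <;> simp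
    have h2 : gronwallBound 0 C (C * ‖(Φ 0).col j‖) t ≤ gronwallBound 0 C (C * 1) t := by
      rw [gronwallBound_of_K_ne_0 hC.ne', gronwallBound_of_K_ne_0 hC.ne']
      have : 0 ≤ Real.exp (C * t) - 1 := by
        have := Real.add_one_le_exp (C * t)
        have := mul_nonneg hC.le ht.1
        linarith
      simp only [zero_mul, zero_add]
      gcongr
    have h3 := h₁ (y := t) (by
      rw [Real.dist_eq, sub_zero, abs_of_nonneg ht.1]
      exact ht.2.trans_le (hT.trans (min_le_left _ _)))
    have h4 := norm_le_pi_norm ((Φ t).col j - (Φ 0).col j) i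
    rw [hΦ.1] at h4 h h2
    exact (h4.trans (h.trans h2)).trans_lt h3

/-! ### Isotropy and the Riccati equation -/

/-- The numerator `Φ₁₁ G + Φ₁₂` of the fractional linear action. -/
def actNum {n : ℕ} (Φ : Matrix (Idx n ⊕ Idx n) (Idx n ⊕ Idx n) ℝ) (G : PhaseMat n) :
    PhaseMat n :=
  Φ.toBlocks₁₁ * G + Φ.toBlocks₁₂

theorem J_mul_doubledHam_mul {n : ℕ} (H : Matrix (Idx n) (Idx n) ℂ)
    (Φ : Matrix (Idx n ⊕ Idx n) (Idx n ⊕ Idx n) ℝ) :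
    Matrix.J (Idx n) ℝ * doubledHam H * Φ = Matrix.fromBlocks
      (reMat H * Om n * Φ.toBlocks₁₁ - imMat H * Φ.toBlocks₂₁)
      (reMat H * Om n * Φ.toBlocks₁₂ - imMat H * Φ.toBlocks₂₂)
      (-((Om n)ᵀ * imMat H * Om n) * Φ.toBlocks₁₁ + Om n * reMat H * Φ.toBlocks₂₁)
      (-((Om n)ᵀ * imMat H * Om n) * Φ.toBlocks₁₂ + Om n * reMat H * Φ.toBlocks₂₂) := by
  conv_lhs => rw [← Matrix.fromBlocks_toBlocks Φ]
  rw [doubledHam, Matrix.J, Matrix.fromBlocks_multiply, Matrix.fromBlocks_multiply]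
  simp [sub_eq_add_neg]

/-- The numerator and the denominator of the fractional linear action solve the doubled linear
system. -/
theorem IsDoubledFlow.hasDeriv_blocks {n : ℕ} {H : ℝ → Matrix (Idx n) (Idx n) ℂ} {T : ℝ}
    {Φ : ℝ → Matrix (Idx n ⊕ Idx n) (Idx n ⊕ Idx n) ℝ} (hΦ : IsDoubledFlow H T Φ)
    (G : PhaseMat n) {t : ℝ} (ht : t ∈ Ico 0 T) :
    (∀ i j, HasDerivWithinAt (fun s => actNum (Φ s) G i j)
      ((reMat (H t) * Om n * actNum (Φ t) G - imMat (H t) * actDenom (Φ t) G) i j)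
      (Ico 0 T) t) ∧
    ∀ i j, HasDerivWithinAt (fun s => actDenom (Φ s) G i j)
      ((-((Om n)ᵀ * imMat (H t) * Om n) * actNum (Φ t) G
        + Om n * reMat (H t) * actDenom (Φ t) G) i j) (Ico 0 T) t := by
  have h := hΦ.2 t ht
  rw [J_mul_doubledHam_mul] at h
  have hG : ∀ i j, HasDerivWithinAt (fun _ : ℝ => G i j) ((0 : PhaseMat n) i j) (Ico 0 T) t :=
    fun i j => hasDerivWithinAt_const _ _ _
  constructor
  · intro i j
    have h1 := hasDerivWithinAt_matrix_mul (A := fun s => (Φ s).toBlocks₁₁) (t := t)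
      (A' := reMat (H t) * Om n * (Φ t).toBlocks₁₁ - imMat (H t) * (Φ t).toBlocks₂₁)
      (B := fun _ => G) (B' := 0)
      (fun i j => h (Sum.inl i) (Sum.inl j)) hG i j
    refine (h1.add (h (Sum.inl i) (Sum.inr j))).congr_deriv ?_
    rw [Matrix.fromBlocks_apply₁₂, ← Matrix.add_apply]
    refine congrFun (congrFun ?_ i) j
    change (reMat (H t) * Om n * (Φ t).toBlocks₁₁ - imMat (H t) * (Φ t).toBlocks₂₁) * G
      + (Φ t).toBlocks₁₁ * 0 + _ = _
    rw [actNum, actDenom]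
    noncomm_ring
  · intro i j
    have h1 := hasDerivWithinAt_matrix_mul (A := fun s => (Φ s).toBlocks₂₁) (t := t)
      (A' := -((Om n)ᵀ * imMat (H t) * Om n) * (Φ t).toBlocks₁₁
        + Om n * reMat (H t) * (Φ t).toBlocks₂₁) (B := fun _ => G) (B' := 0)
      (fun i j => h (Sum.inr i) (Sum.inl j)) hG i j
    refine (h1.add (h (Sum.inr i) (Sum.inr j))).congr_deriv ?_
    rw [Matrix.fromBlocks_apply₂₂, ← Matrix.add_apply]
    refine congrFun (congrFun ?_ i) j
    change (-((Om n)ᵀ * imMat (H t) * Om n) * (Φ t).toBlocks₁₁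
      + Om n * reMat (H t) * (Φ t).toBlocks₂₁) * G + (Φ t).toBlocks₂₁ * 0 + _ = _
    rw [actNum, actDenom]
    noncomm_ring

theorem Om_transpose (n : ℕ) : (Om n)ᵀ = -Om n := Matrix.J_transpose _ _

/-- The blocks stay isotropic: `Pᵀ Q` is symmetric along the flow, because the derivative of
`Pᵀ Q - Qᵀ P` vanishes. -/
theorem IsDoubledFlow.isotropic {n : ℕ} {H : ℝ → Matrix (Idx n) (Idx n) ℂ} {T : ℝ}
    (hH : ∀ t, 0 ≤ t → (H t).IsSymm)
    {Φ : ℝ → Matrix (Idx n ⊕ Idx n) (Idx n ⊕ Idx n) ℝ} (hΦ : IsDoubledFlow H T Φ)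
    {G : PhaseMat n} (hG : Gᵀ = G) {t : ℝ} (ht : t ∈ Ico 0 T) :
    (actNum (Φ t) G)ᵀ * actDenom (Φ t) G = (actDenom (Φ t) G)ᵀ * actNum (Φ t) G := by
  have hd : ∀ s ∈ Ico 0 T, ∀ i j, HasDerivWithinAt
      (fun s => ((actNum (Φ s) G)ᵀ * actDenom (Φ s) G) i j
        - ((actDenom (Φ s) G)ᵀ * actNum (Φ s) G) i j) 0 (Ico 0 T) s := by
    intro s hs i j
    obtain ⟨hP, hQ⟩ := hΦ.hasDeriv_blocks G hs
    have h1 := hasDerivWithinAt_matrix_mul (hasDerivWithinAt_matrix_transpose hP) hQ i j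
    have h2 := hasDerivWithinAt_matrix_mul (hasDerivWithinAt_matrix_transpose hQ) hP i j
    refine (h1.sub h2).congr_deriv ?_
    rw [← Matrix.sub_apply]
    refine (congrFun (congrFun (?_ : _ = (0 : PhaseMat n)) i) j)
    simp only [Matrix.transpose_sub, Matrix.transpose_add, Matrix.transpose_neg,
      Matrix.transpose_mul, reMat_isSymm (hH s hs.1), imMat_isSymm (hH s hs.1), Om_transpose]
    noncomm_ring
  have hconst : ∀ i j, ((actNum (Φ t) G)ᵀ * actDenom (Φ t) G) i j
      - ((actDenom (Φ t) G)ᵀ * actNum (Φ t) G) i j = 0 := by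
    intro i j
    have h0 : (0 : ℝ) ∈ Ico 0 T := ⟨le_rfl, ht.1.trans_lt ht.2⟩
    have := (convex_Ico 0 T).norm_image_sub_le_of_norm_hasDerivWithin_le (C := 0)
      (fun s hs => hd s hs i j) (by simp) h0 ht
    rw [zero_mul, norm_le_zero_iff, sub_eq_zero] at this
    rw [this, hΦ.1, actDenom_one]
    have h1 : actNum (1 : Matrix (Idx n ⊕ Idx n) (Idx n ⊕ Idx n) ℝ) G = G := by
      have := act_one G
      rwa [act, actDenom_one, inv_one, mul_one] at this
    rw [h1, hG]
    simp
  ext i j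
  exact sub_eq_zero.1 (hconst i j)

theorem IsDoubledFlow.act_transpose {n : ℕ} {H : ℝ → Matrix (Idx n) (Idx n) ℂ} {T : ℝ}
    (hH : ∀ t, 0 ≤ t → (H t).IsSymm)
    {Φ : ℝ → Matrix (Idx n ⊕ Idx n) (Idx n ⊕ Idx n) ℝ} (hΦ : IsDoubledFlow H T Φ)
    {G : PhaseMat n} (hG : Gᵀ = G) {t : ℝ} (ht : t ∈ Ico 0 T)
    (hu : IsUnit (actDenom (Φ t) G)) : (act (Φ t) G)ᵀ = act (Φ t) G := by
  have hdet := (Matrix.isUnit_iff_isUnit_det _).1 hu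
  have hdet' : IsUnit (actDenom (Φ t) G)ᵀ.det := by rwa [Matrix.det_transpose]
  have h := hΦ.isotropic hH hG ht
  change (actNum (Φ t) G * (actDenom (Φ t) G)⁻¹)ᵀ = actNum (Φ t) G * (actDenom (Φ t) G)⁻¹
  rw [Matrix.transpose_mul, Matrix.transpose_nonsing_inv]
  calc _ = (actDenom (Φ t) G)ᵀ⁻¹ *
        ((actNum (Φ t) G)ᵀ * actDenom (Φ t) G) * (actDenom (Φ t) G)⁻¹ := by
        rw [mul_assoc, mul_assoc, Matrix.mul_nonsing_inv _ hdet, mul_one]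
    _ = _ := by
        rw [h, ← mul_assoc, Matrix.nonsing_inv_mul _ hdet', one_mul]

/-- Differentiating `P Q⁻¹` along a linear system for `(P, Q)` gives the Riccati right-hand side;
`Qi` stands for `Q⁻¹`. -/
theorem riccati_algebra {n : ℕ} {A K S D P Q Qi : PhaseMat n} (h : Q * Qi = 1) :
    (A * P - K * Q) * Qi + P * -(Qi * (-S * P + D * Q) * Qi)
      = A * (P * Qi) - K + P * Qi * S * (P * Qi) - P * Qi * D := by
  have e : ∀ M : PhaseMat n, M * Q * Qi = M := fun M => by rw [mul_assoc, h, mul_one]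
  calc _ = A * (P * Qi) - K * Q * Qi + P * Qi * S * (P * Qi) - P * Qi * D * Q * Qi := by
        noncomm_ring
    _ = _ := by rw [e, e]

/-- The Riccati equation satisfied by the fractional linear action along the doubled flow. -/
theorem IsDoubledFlow.hasDeriv_act {n : ℕ} {H : ℝ → Matrix (Idx n) (Idx n) ℂ} {T : ℝ}
    {Φ : ℝ → Matrix (Idx n ⊕ Idx n) (Idx n ⊕ Idx n) ℝ} (hΦ : IsDoubledFlow H T Φ)
    {G : PhaseMat n} (hu : ∀ t ∈ Ico 0 T, IsUnit (actDenom (Φ t) G)) {t : ℝ}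
    (ht : t ∈ Ico 0 T) (i j : Idx n) :
    HasDerivWithinAt (fun s => act (Φ s) G i j)
      ((reMat (H t) * Om n * act (Φ t) G - imMat (H t)
        + act (Φ t) G * ((Om n)ᵀ * imMat (H t) * Om n) * act (Φ t) G
        - act (Φ t) G * (Om n * reMat (H t))) i j) (Ico 0 T) t := by
  obtain ⟨hP, hQ⟩ := hΦ.hasDeriv_blocks G ht
  have hdet := (Matrix.isUnit_iff_isUnit_det _).1 (hu t ht)
  have hact : ∀ s, act (Φ s) G = actNum (Φ s) G * (actDenom (Φ s) G)⁻¹ := fun _ => rfl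
  simp only [hact]
  rw [← riccati_algebra (Matrix.mul_nonsing_inv _ hdet)]
  exact hasDerivWithinAt_matrix_mul hP (hasDerivWithinAt_matrix_inv ht hu hQ) i j

/-! ### Centre and normalisation -/

theorem posDef_of_lower_bound {n : ℕ} {G : PhaseMat n} (hG : Gᵀ = G) {c : ℝ} (hc : 0 < c)
    (h : ∀ z : PhaseSpace n, c * ‖z‖ ^ 2 ≤ z ⬝ᵥ (G *ᵥ z)) : G.PosDef := by
  refine Matrix.PosDef.of_dotProduct_mulVec_pos ?_ fun z hz => ?_
  · rw [Matrix.IsHermitian, Matrix.conjTranspose_eq_transpose_of_trivial, hG]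
  · have : 0 < ‖z‖ := norm_pos_iff.2 hz
    simpa using lt_of_lt_of_le (by positivity) (h z)

theorem hasDerivWithinAt_mulVec {l m : Type*} [Fintype l] [Fintype m] {M : ℝ → Matrix l m ℝ}
    {M' : Matrix l m ℝ}
    {v : ℝ → m → ℝ} {v' : m → ℝ} {S : Set ℝ} {t : ℝ}
    (hM : ∀ i j, HasDerivWithinAt (fun s => M s i j) (M' i j) S t)
    (hv : HasDerivWithinAt v v' S t) :
    HasDerivWithinAt (fun s => M s *ᵥ v s) (M' *ᵥ v t + M t *ᵥ v') S t := by
  refine hasDerivWithinAt_pi.2 fun i => ?_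
  simp only [Matrix.mulVec, dotProduct, Pi.add_apply, ← Finset.sum_add_distrib]
  exact HasDerivWithinAt.fun_sum fun j _ => (hM i j).mul (hasDerivWithinAt_pi.1 hv j)

theorem hasDerivWithinAt_dotProduct {m : Type*} [Fintype m] {u v : ℝ → m → ℝ} {u' v' : m → ℝ}
    {S : Set ℝ} {t : ℝ} (hu : HasDerivWithinAt u u' S t) (hv : HasDerivWithinAt v v' S t) :
    HasDerivWithinAt (fun s => u s ⬝ᵥ v s) (u' ⬝ᵥ v t + u t ⬝ᵥ v') S t := by
  simp only [dotProduct, ← Finset.sum_add_distrib]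
  exact HasDerivWithinAt.fun_sum fun j _ =>
    (hasDerivWithinAt_pi.1 hu j).mul (hasDerivWithinAt_pi.1 hv j)

theorem exists_antideriv {f : ℝ → ℝ} {T : ℝ} (hf : ContinuousOn f (Ico 0 T)) :
    ∃ F : ℝ → ℝ, F 0 = 0 ∧ ∀ t ∈ Ico 0 T, HasDerivWithinAt F (f t) (Ico 0 T) t := by
  refine ⟨fun t => ∫ s in (0 : ℝ)..t, f s, by simp, fun t ht => ?_⟩
  obtain ⟨b, htb, hbT⟩ := exists_between ht.2
  have hsub : Icc 0 b ⊆ Ico 0 T := fun s hs => ⟨hs.1, hs.2.trans_lt hbT⟩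
  have htI : t ∈ Icc 0 b := ⟨ht.1, htb.le⟩
  have : Fact (t ∈ Icc 0 b) := ⟨htI⟩
  have h := intervalIntegral.integral_hasDerivWithinAt_right (a := 0) (b := t) (f := f)
    (s := Icc 0 b) (t := Icc 0 b)
    ((hf.mono ((Icc_subset_Icc_right htb.le).trans hsub)).intervalIntegrable_of_Icc ht.1)
    ((hf.mono hsub).stronglyMeasurableAtFilter_nhdsWithin measurableSet_Icc t)
    ((hf.mono hsub) t htI)
  refine h.mono_of_mem_nhdsWithin ?_
  rw [mem_nhdsWithin]
  exact ⟨Iio b, isOpen_Iio, htb, fun s hs => ⟨hs.2.1, le_of_lt hs.1⟩⟩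

/-- Differentiating `(Pᵀ)⁻¹` along the linear system: the result is the generator of the equation of
the centre. Here `P`, `Q` are the transposes of numerator and denominator and `Pi` is the inverse of
`P`. -/
theorem centre_algebra {n : ℕ} {W R K P Q Pi : PhaseMat n} (h : Pi * P = 1) :
    -(Pi * (P * (-W * R) - Q * K) * Pi) = W * R * Pi + Pi * Q * K * Pi := by
  calc _ = Pi * P * (W * R * Pi) + Pi * Q * K * Pi := by noncomm_ring
    _ = _ := by rw [h, one_mul]

/-- The centre is explicit: `Z(t) = (P(t)ᵀ)⁻¹ G Z₀` with `P = Φ₁₁ G + Φ₁₂`, because `Pᵀ Z` is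
conserved. -/
theorem IsDoubledFlow.exists_centre {n : ℕ} {H : ℝ → Matrix (Idx n) (Idx n) ℂ} {T : ℝ}
    (hH : ∀ t, 0 ≤ t → (H t).IsSymm)
    {Φ : ℝ → Matrix (Idx n ⊕ Idx n) (Idx n ⊕ Idx n) ℝ} (hΦ : IsDoubledFlow H T Φ)
    {G : PhaseMat n} (hG : G.PosDef) (hu : ∀ t ∈ Ico 0 T, IsUnit (actDenom (Φ t) G))
    (hpos : ∀ t ∈ Ico 0 T, (act (Φ t) G).PosDef) (Z₀ : PhaseSpace n) :
    ∃ Z, IsCentre H T (fun t => act (Φ t) G) Z₀ Z := by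
  have hGt : Gᵀ = G := by
    rw [← Matrix.conjTranspose_eq_transpose_of_trivial]
    exact hG.1
  have hact : ∀ s, act (Φ s) G = actNum (Φ s) G * (actDenom (Φ s) G)⁻¹ := fun _ => rfl
  have hnum : ∀ t ∈ Ico 0 T, actNum (Φ t) G = act (Φ t) G * actDenom (Φ t) G := fun t ht => by
    have hdet := (Matrix.isUnit_iff_isUnit_det _).1 (hu t ht)
    rw [hact, mul_assoc, Matrix.nonsing_inv_mul _ hdet, mul_one]
  have huP : ∀ t ∈ Ico 0 T, IsUnit (actNum (Φ t) G)ᵀ := fun t ht => by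
    rw [Matrix.isUnit_transpose, hnum t ht]
    exact (hpos t ht).isUnit.mul (hu t ht)
  refine ⟨fun t => ((actNum (Φ t) G)ᵀ)⁻¹ *ᵥ (G *ᵥ Z₀), ?_, fun t ht => ?_⟩
  · have h1 : actNum (1 : Matrix (Idx n ⊕ Idx n) (Idx n ⊕ Idx n) ℝ) G = G := by
      have := act_one G
      rwa [act, actDenom_one, inv_one, mul_one] at this
    have hdet := (Matrix.isUnit_iff_isUnit_det _).1 hG.isUnit
    simp only [hΦ.1, h1, hGt, Matrix.mulVec_mulVec, Matrix.nonsing_inv_mul _ hdet,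
      Matrix.one_mulVec]
  · obtain ⟨hP, -⟩ := hΦ.hasDeriv_blocks G ht
    have hd := hasDerivWithinAt_mulVec
      (hasDerivWithinAt_matrix_inv ht huP (hasDerivWithinAt_matrix_transpose hP))
      (hasDerivWithinAt_const t (Ico 0 T) (G *ᵥ Z₀))
    refine hd.congr_deriv ?_
    have hdet := (Matrix.isUnit_iff_isUnit_det _).1 (huP t ht)
    have hinv : (act (Φ t) G)⁻¹ = ((actNum (Φ t) G)ᵀ)⁻¹ * (actDenom (Φ t) G)ᵀ := by
      have hdet' : IsUnit (actDenom (Φ t) G)ᵀ.det := by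
        rw [Matrix.det_transpose]
        exact (Matrix.isUnit_iff_isUnit_det _).1 (hu t ht)
      rw [← hΦ.act_transpose hH hGt ht (hu t ht), hact, Matrix.transpose_mul,
        Matrix.transpose_nonsing_inv, Matrix.mul_inv_rev, Matrix.nonsing_inv_nonsing_inv _ hdet']
    have hinv1 := Matrix.nonsing_inv_mul _ hdet
    rw [Matrix.transpose_sub, Matrix.transpose_mul, Matrix.transpose_mul, Matrix.transpose_mul,
      reMat_isSymm (hH t ht.1), imMat_isSymm (hH t ht.1), Om_transpose,
      centre_algebra (Matrix.nonsing_inv_mul _ hdet), hinv, Matrix.mulVec_zero, add_zero]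
    simp only [Matrix.mulVec_mulVec, Matrix.add_mulVec, Matrix.mul_assoc, add_mul]

/-- A moving Gaussian: on `[0, T)` the quadratic form `G`, the centre `Z` and the logarithmic
normalisation `β` satisfy the equations of motion, with `G` symmetric and bounded below by `c > 0`
uniformly in time. -/
structure IsGaussianPath {n : ℕ} (hbar c : ℝ) (H : ℝ → Matrix (Idx n) (Idx n) ℂ) (T : ℝ)
    (G : ℝ → PhaseMat n) (Z : ℝ → PhaseSpace n) (β : ℝ → ℝ) : Prop where
  hbar_pos : 0 < hbar
  c_pos : 0 < c
  contH : ContinuousOn H (Ici 0)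
  symmH : ∀ t, 0 ≤ t → (H t).IsSymm
  symm : ∀ t ∈ Ico 0 T, (G t)ᵀ = G t
  lower : ∀ t ∈ Ico 0 T, ∀ z : PhaseSpace n, c * ‖z‖ ^ 2 ≤ z ⬝ᵥ (G t *ᵥ z)
  derivG : ∀ t ∈ Ico 0 T, ∀ i j, HasDerivWithinAt (fun s => G s i j)
    ((reMat (H t) * Om n * G t - imMat (H t) + G t * ((Om n)ᵀ * imMat (H t) * Om n) * G t
      - G t * (Om n * reMat (H t))) i j) (Ico 0 T) t
  derivZ : ∀ t ∈ Ico 0 T, HasDerivWithinAt Z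
    ((Om n * reMat (H t)) *ᵥ Z t + ((G t)⁻¹ * imMat (H t)) *ᵥ Z t) (Ico 0 T) t
  derivβ : ∀ t ∈ Ico 0 T, HasDerivWithinAt β
    (-(1 / hbar) * (Z t ⬝ᵥ (imMat (H t) *ᵥ Z t))
      - 1 / 2 * (imMat (H t) * Om n * G t * (Om n)ᵀ).trace) (Ico 0 T) t

theorem exists_normalisation {n : ℕ} {hbar T : ℝ} {H : ℝ → Matrix (Idx n) (Idx n) ℂ}
    (hH : ContinuousOn H (Ici 0)) {G : ℝ → PhaseMat n} {Z : ℝ → PhaseSpace n}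
    (hG : ContinuousOn G (Ico 0 T)) (hZ : ContinuousOn Z (Ico 0 T)) :
    ∃ β, IsNormalisation hbar H T G Z β := by
  have hK : ContinuousOn (fun t => imMat (H t)) (Ico 0 T) :=
    continuous_imMat.comp_continuousOn (hH.mono Ico_subset_Ici_self)
  have h1 : ContinuousOn (fun t => Z t ⬝ᵥ (imMat (H t) *ᵥ Z t)) (Ico 0 T) := by
    rw [continuousOn_iff_continuous_domRestrict] at hK hZ ⊢
    exact hZ.dotProduct (hK.matrix_mulVec hZ)
  have h2 : ContinuousOn (fun t => (imMat (H t) * Om n * G t * (Om n)ᵀ).trace) (Ico 0 T) := by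
    rw [continuousOn_iff_continuous_domRestrict] at hK hG ⊢
    exact (((hK.matrix_mul continuous_const).matrix_mul hG).matrix_mul
      continuous_const).matrix_trace
  exact exists_antideriv ((continuousOn_const.mul h1).sub (continuousOn_const.mul h2))

/-- The logarithmic time derivative of a moving Gaussian, for given velocities of its parameters. -/
def gaussianRate {n : ℕ} (hbar : ℝ) (G G' : PhaseMat n) (Z Z' : PhaseSpace n) (b' : ℝ)
    (z : PhaseSpace n) : ℝ :=
  -b' - 1 / hbar * ((z - Z) ⬝ᵥ (G' *ᵥ (z - Z)) - 2 * ((z - Z) ⬝ᵥ (G *ᵥ Z')))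

theorem hasDerivWithinAt_gaussian {n : ℕ} {hbar : ℝ} {G : ℝ → PhaseMat n} {G' : PhaseMat n}
    {Z : ℝ → PhaseSpace n} {Z' : PhaseSpace n} {β : ℝ → ℝ} {b' : ℝ} {S : Set ℝ} {t : ℝ}
    (hsymm : (G t)ᵀ = G t)
    (hG : ∀ i j, HasDerivWithinAt (fun s => G s i j) (G' i j) S t)
    (hZ : HasDerivWithinAt Z Z' S t) (hβ : HasDerivWithinAt β b' S t) (z : PhaseSpace n) :
    HasDerivWithinAt (fun s => gaussian hbar (β s) (Z s) (G s) z)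
      (gaussian hbar (β t) (Z t) (G t) z * gaussianRate hbar (G t) G' (Z t) Z' b' z) S t := by
  have hy : HasDerivWithinAt (fun s => z - Z s) (-Z') S t := hZ.const_sub z
  have hq := hasDerivWithinAt_dotProduct hy (hasDerivWithinAt_mulVec hG hy)
  have h := (hβ.neg.exp.div_const ((Real.pi * hbar) ^ n)).mul
    ((hq.const_mul (-(1 / hbar))).exp)
  refine h.congr_deriv ?_
  have hs : Z' ⬝ᵥ (G t *ᵥ (z - Z t)) = (z - Z t) ⬝ᵥ (G t *ᵥ Z') := by
    rw [Matrix.dotProduct_mulVec, ← Matrix.mulVec_transpose, hsymm, dotProduct_comm]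
  simp only [Pi.neg_apply, gaussian, gaussianRate, neg_dotProduct, Matrix.mulVec_neg,
    dotProduct_add, dotProduct_neg, hs]
  ring

/-! ### Vector calculus on phase space -/

theorem grad_mul {n : ℕ} {f g : PhaseSpace n → ℝ} {z : PhaseSpace n}
    (hf : DifferentiableAt ℝ f z) (hg : DifferentiableAt ℝ g z) :
    grad (fun y => f y * g y) z = f z • grad g z + g z • grad f z := by
  funext i
  simp [grad, fderiv_fun_mul hf hg]

theorem grad_const_mul {n : ℕ} {f : PhaseSpace n → ℝ} {z : PhaseSpace n} (a : ℝ)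
    (hf : DifferentiableAt ℝ f z) : grad (fun y => a * f y) z = a • grad f z := by
  funext i
  simp [grad, fderiv_const_mul hf]

theorem diverg_smul {n : ℕ} {f : PhaseSpace n → ℝ} {F : PhaseSpace n → PhaseSpace n}
    {z : PhaseSpace n} (hf : DifferentiableAt ℝ f z) (hF : DifferentiableAt ℝ F z) :
    diverg (fun y => f y • F y) z = f z * diverg F z + grad f z ⬝ᵥ F z := by
  have hFi := fun i => differentiableAt_pi.1 hF i
  simp only [diverg, grad, dotProduct, Finset.mul_sum, ← Finset.sum_add_distrib, Pi.smul_apply,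
    smul_eq_mul]
  refine Finset.sum_congr rfl fun i _ => ?_
  rw [fderiv_fun_mul hf (hFi i)]
  simp only [add_apply, smul_apply, smul_eq_mul]
  ring

theorem diverg_add {n : ℕ} {F F' : PhaseSpace n → PhaseSpace n} {z : PhaseSpace n}
    (hF : DifferentiableAt ℝ F z) (hF' : DifferentiableAt ℝ F' z) :
    diverg (fun y => F y + F' y) z = diverg F z + diverg F' z := by
  simp only [diverg, ← Finset.sum_add_distrib, Pi.add_apply]
  refine Finset.sum_congr rfl fun i _ => ?_
  rw [fderiv_fun_add (differentiableAt_pi.1 hF i) (differentiableAt_pi.1 hF' i)]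
  rfl

theorem diverg_mulVec_sub {n : ℕ} (M : PhaseMat n) (Z z : PhaseSpace n) :
    diverg (fun y => M *ᵥ (y - Z)) z = M.trace := by
  simp only [diverg, Matrix.trace, Matrix.diag]
  refine Finset.sum_congr rfl fun i _ => ?_
  have h : HasFDerivAt (fun y : PhaseSpace n => (M *ᵥ (y - Z)) i)
      (∑ j, M i j • ContinuousLinearMap.proj (R := ℝ) (φ := fun _ : Idx n => ℝ) j) z := by
    simp only [Matrix.mulVec, dotProduct]
    exact HasFDerivAt.fun_sum fun j _ => ((hasFDerivAt_apply j z).sub_const _).const_mul _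
  rw [h.fderiv, sum_apply, Finset.sum_eq_single i (fun j _ hj => by simp [hj]) (by simp)]
  simp

theorem diverg_vecMul {n : ℕ} (M : PhaseMat n) (z : PhaseSpace n) :
    diverg (fun y => y ᵥ* M) z = M.trace := by
  have := diverg_mulVec_sub Mᵀ 0 z
  simpa [Matrix.mulVec_transpose] using this

theorem differentiable_mulVec {n : ℕ} (M : PhaseMat n) {F : PhaseSpace n → PhaseSpace n}
    (hF : Differentiable ℝ F) : Differentiable ℝ fun y => M *ᵥ F y := by
  refine differentiable_pi.2 fun i => ?_
  simp only [Matrix.mulVec, dotProduct]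
  exact Differentiable.fun_sum fun j _ => (differentiable_pi.1 hF j).const_mul _

theorem differentiable_vecMul {n : ℕ} (M : PhaseMat n) :
    Differentiable ℝ fun y : PhaseSpace n => y ᵥ* M := by
  simp only [← Matrix.mulVec_transpose]
  exact differentiable_mulVec _ differentiable_id

theorem contDiff_grad {n : ℕ} {f : PhaseSpace n → ℝ} {m k : WithTop ℕ∞} (hf : ContDiff ℝ m f)
    (hk : k + 1 ≤ m) : ContDiff ℝ k (grad f) :=
  contDiff_pi.2 fun _ => (hf.fderiv_right hk).clm_apply contDiff_const

theorem differentiable_grad {n : ℕ} {f : PhaseSpace n → ℝ} (hf : ContDiff ℝ 2 f) :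
    Differentiable ℝ (grad f) :=
  (contDiff_grad (k := 1) hf (by norm_num)).differentiable one_ne_zero

theorem dotProduct_mulVec_transpose {n : ℕ} (M : PhaseMat n) (u v : PhaseSpace n) :
    u ⬝ᵥ (M *ᵥ v) = v ⬝ᵥ (Mᵀ *ᵥ u) := by
  rw [Matrix.dotProduct_mulVec, ← Matrix.mulVec_transpose, dotProduct_comm]

theorem dotProduct_mulVec_symm {n : ℕ} {M : PhaseMat n} (hM : Mᵀ = M) (u v : PhaseSpace n) :
    u ⬝ᵥ (M *ᵥ v) = v ⬝ᵥ (M *ᵥ u) := by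
  rw [dotProduct_mulVec_transpose, hM]

theorem conj_Om_isSymm {n : ℕ} {K : PhaseMat n} (hK : Kᵀ = K) :
    ((Om n)ᵀ * K * Om n)ᵀ = (Om n)ᵀ * K * Om n := by
  rw [Matrix.transpose_mul, Matrix.transpose_mul, Matrix.transpose_transpose, hK, mul_assoc]

theorem lapl_mul {n : ℕ} {K : PhaseMat n} (hK : Kᵀ = K) {f g : PhaseSpace n → ℝ}
    (hf : ContDiff ℝ 2 f) (hg : ContDiff ℝ 2 g) (z : PhaseSpace n) :
    lapl K (fun y => f y * g y) z = f z * lapl K g z + g z * lapl K f z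
      - 2 * (grad f z ⬝ᵥ (((Om n)ᵀ * K * Om n) *ᵥ grad g z)) := by
  have hfd : Differentiable ℝ f := hf.differentiable two_ne_zero
  have hgd : Differentiable ℝ g := hg.differentiable two_ne_zero
  simp only [lapl]
  have e : (fun y => ((Om n)ᵀ * K * Om n) *ᵥ grad (fun y => f y * g y) y) =
      fun y => f y • (((Om n)ᵀ * K * Om n) *ᵥ grad g y)
        + g y • (((Om n)ᵀ * K * Om n) *ᵥ grad f y) := by
    funext y
    rw [grad_mul (hfd y) (hgd y), Matrix.mulVec_add, Matrix.mulVec_smul, Matrix.mulVec_smul]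
  have h1 := differentiable_mulVec ((Om n)ᵀ * K * Om n) (differentiable_grad hf)
  have h2 := differentiable_mulVec ((Om n)ᵀ * K * Om n) (differentiable_grad hg)
  rw [e, diverg_add ((hfd z).fun_smul (h2 z)) ((hgd z).fun_smul (h1 z)), diverg_smul (hfd z) (h2 z),
    diverg_smul (hgd z) (h1 z),
    dotProduct_mulVec_symm (conj_Om_isSymm hK) (grad g z) (grad f z)]
  ring

theorem trace_reMat_mul_Om {n : ℕ} {R : PhaseMat n} (hR : Rᵀ = R) : (R * Om n).trace = 0 := by
  have h : (R * Om n).trace = -(R * Om n).trace := by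
    conv_lhs => rw [← Matrix.trace_transpose, Matrix.transpose_mul, hR, Om_transpose,
      Matrix.neg_mul, Matrix.trace_neg, Matrix.trace_mul_comm]
  linarith

/-- The commutator of the transposed operator with multiplication by `χ`, applied to `f`; every term
contains a derivative of `χ`. -/
def cutoffError {n : ℕ} (hbar : ℝ) (H : Matrix (Idx n) (Idx n) ℂ) (χ f : PhaseSpace n → ℝ)
    (z : PhaseSpace n) : ℝ :=
  hbar ^ 2 / 4 * (f z * lapl (imMat H) χ z
    - 2 * (grad χ z ⬝ᵥ (((Om n)ᵀ * imMat H * Om n) *ᵥ grad f z)))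
    - hbar * (f z * (grad χ z ⬝ᵥ (z ᵥ* (reMat H * Om n))))

theorem wignerOpTranspose_mul {n : ℕ} (hbar : ℝ) {H : Matrix (Idx n) (Idx n) ℂ} (hH : H.IsSymm)
    {χ f : PhaseSpace n → ℝ} (hχ : ContDiff ℝ 2 χ) (hf : ContDiff ℝ 2 f) (z : PhaseSpace n) :
    wignerOpTranspose hbar H (fun y => χ y * f y) z =
      χ z * wignerOpTranspose hbar H f z + cutoffError hbar H χ f z := by
  have hχd : Differentiable ℝ χ := hχ.differentiable two_ne_zero
  have hfd : Differentiable ℝ f := hf.differentiable two_ne_zero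
  have hv := differentiable_vecMul (reMat H * Om n)
  rw [wignerOpTranspose, wignerOpTranspose, cutoffError, lapl_mul (imMat_isSymm hH) hχ hf,
    diverg_smul ((hχd z).fun_mul (hfd z)) (hv z), diverg_smul (hfd z) (hv z),
    grad_mul (hχd z) (hfd z), add_dotProduct, smul_dotProduct, smul_dotProduct, smul_eq_mul,
    smul_eq_mul]
  ring

/-- The transposed operator is the operator for the Hamiltonian with reversed real part: this is
what makes the backward adjoint equation of the same type as the original equation. -/
theorem wignerOpTranspose_eq {n : ℕ} (hbar : ℝ) {H H' : Matrix (Idx n) (Idx n) ℂ}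
    (hH : H.IsSymm) (hre : reMat H' = -reMat H) (him : imMat H' = imMat H)
    {f : PhaseSpace n → ℝ} (hf : ContDiff ℝ 2 f) (z : PhaseSpace n) :
    wignerOpTranspose hbar H f z = wignerOp hbar H' f z := by
  have hfd : Differentiable ℝ f := hf.differentiable two_ne_zero
  have hv := differentiable_vecMul (reMat H * Om n)
  rw [wignerOpTranspose, wignerOp, hre, him, diverg_smul (hfd z) (hv z), diverg_vecMul,
    trace_reMat_mul_Om (reMat_isSymm hH), Matrix.neg_mul, Matrix.neg_mulVec, dotProduct_neg,
    Matrix.dotProduct_mulVec z (reMat H * Om n), dotProduct_comm (grad f z)]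
  ring

/-! ### The Gaussian as a classical solution -/

theorem contDiff_gaussian {n : ℕ} (hbar b : ℝ) (Z : PhaseSpace n) (G : PhaseMat n)
    {k : WithTop ℕ∞} : ContDiff ℝ k (gaussian hbar b Z G) := by
  unfold gaussian
  simp only [dotProduct, Matrix.mulVec]
  refine contDiff_const.mul (Real.contDiff_exp.comp (contDiff_const.mul ?_))
  refine ContDiff.sum fun i _ => ContDiff.mul ?_ (ContDiff.sum fun j _ => contDiff_const.mul ?_)
  · exact (contDiff_apply ℝ ℝ i).sub contDiff_const
  · exact (contDiff_apply ℝ ℝ j).sub contDiff_const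

theorem grad_gaussian {n : ℕ} (hbar b : ℝ) (Z : PhaseSpace n) {G : PhaseMat n} (hG : Gᵀ = G)
    (z : PhaseSpace n) :
    grad (gaussian hbar b Z G) z = (-(2 / hbar) * gaussian hbar b Z G z) • (G *ᵥ (z - Z)) := by
  funext i
  have hd : DifferentiableAt ℝ (gaussian hbar b Z G) z :=
    (contDiff_gaussian hbar b Z G (k := 1)).differentiable one_ne_zero z
  -- moving the argument along `e` is the same as moving the centre along `-e`
  have e : ∀ s : ℝ, gaussian hbar b Z G (z + s • Pi.single i 1)
      = gaussian hbar b (Z - s • Pi.single i 1) G z := fun s => by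
    simp only [gaussian]
    rw [show z + s • Pi.single i (1 : ℝ) - Z = z - (Z - s • Pi.single i 1) by abel]
  have h0 : HasDerivAt (fun s : ℝ => Z - s • Pi.single (M := fun _ => ℝ) i 1)
      (-((1 : ℝ) • Pi.single i 1)) 0 :=
    ((hasDerivAt_id (0 : ℝ)).smul_const _).const_sub _
  have h1 := hasDerivWithinAt_gaussian (hbar := hbar) (G := fun _ => G) (G' := 0) (t := 0) hG
    (fun i j => hasDerivWithinAt_const _ _ _) (h0.hasDerivWithinAt (s := univ))
    (hasDerivWithinAt_const (0 : ℝ) univ b) z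
  rw [hasDerivWithinAt_univ] at h1
  have h2 : HasDerivAt (fun s : ℝ => gaussian hbar b Z G (z + s • Pi.single i 1))
      (fderiv ℝ (gaussian hbar b Z G) z (Pi.single i 1)) 0 :=
    hd.hasFDerivAt.hasLineDerivAt (Pi.single i 1)
  simp only [e] at h2
  rw [grad, h2.unique h1]
  simp only [gaussianRate, one_smul, zero_smul, sub_zero, Matrix.zero_mulVec, dotProduct_zero,
    Matrix.mulVec_neg, dotProduct_neg, Pi.smul_apply, smul_eq_mul,
    dotProduct_mulVec_symm hG (z - Z), single_one_dotProduct]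
  ring

theorem lapl_gaussian {n : ℕ} (hbar b : ℝ) (Z : PhaseSpace n) {G : PhaseMat n} (hG : Gᵀ = G)
    (K : PhaseMat n) (z : PhaseSpace n) :
    lapl K (gaussian hbar b Z G) z = gaussian hbar b Z G z *
      (2 / hbar * ((Om n)ᵀ * K * Om n * G).trace - (2 / hbar) ^ 2 *
        ((G *ᵥ (z - Z)) ⬝ᵥ (((Om n)ᵀ * K * Om n) *ᵥ (G *ᵥ (z - Z))))) := by
  have hd : Differentiable ℝ (gaussian hbar b Z G) :=
    (contDiff_gaussian hbar b Z G (k := 1)).differentiable one_ne_zero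
  have hF : Differentiable ℝ fun y : PhaseSpace n => ((Om n)ᵀ * K * Om n * G) *ᵥ (y - Z) :=
    differentiable_mulVec _ (differentiable_id.sub_const Z)
  have e : (fun y => ((Om n)ᵀ * K * Om n) *ᵥ grad (gaussian hbar b Z G) y) =
      fun y => (-(2 / hbar) * gaussian hbar b Z G y) • (((Om n)ᵀ * K * Om n * G) *ᵥ (y - Z)) := by
    funext y
    rw [grad_gaussian hbar b Z hG, Matrix.mulVec_smul, Matrix.mulVec_mulVec]
  rw [lapl, e, diverg_smul ((hd z).const_mul _) (hF z), diverg_mulVec_sub,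
    grad_const_mul _ (hd z), grad_gaussian hbar b Z hG, smul_dotProduct, smul_dotProduct,
    Matrix.mulVec_mulVec (z - Z) ((Om n)ᵀ * K * Om n) G]
  simp only [smul_eq_mul]
  ring

/-- The Gaussian ansatz closes: the operator multiplies a Gaussian by `ħ` times its logarithmic time
derivative under the Riccati equation for `G` and the equations for centre and normalisation. -/
theorem wignerOp_gaussian {n : ℕ} {hbar b : ℝ} (hbar0 : hbar ≠ 0) {Z : PhaseSpace n}
    {G : PhaseMat n} (hG : Gᵀ = G) (hGu : IsUnit G) {H : Matrix (Idx n) (Idx n) ℂ}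
    (hH : H.IsSymm) (z : PhaseSpace n) :
    wignerOp hbar H (gaussian hbar b Z G) z = hbar * (gaussian hbar b Z G z *
      gaussianRate hbar G
        (reMat H * Om n * G - imMat H + G * ((Om n)ᵀ * imMat H * Om n) * G
          - G * (Om n * reMat H)) Z
        ((Om n * reMat H) *ᵥ Z + (G⁻¹ * imMat H) *ᵥ Z)
        (-(1 / hbar) * (Z ⬝ᵥ (imMat H *ᵥ Z)) - 1 / 2 * (imMat H * Om n * G * (Om n)ᵀ).trace)
        z) := by
  have hK := imMat_isSymm hH
  have hR := reMat_isSymm hH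
  have hdet := (Matrix.isUnit_iff_isUnit_det _).1 hGu
  rw [wignerOp, lapl_gaussian hbar b Z hG, grad_gaussian hbar b Z hG, gaussianRate]
  obtain ⟨y, hy⟩ : ∃ y, y = z - Z := ⟨_, rfl⟩
  have hz : z = y + Z := by rw [hy]; abel
  rw [← hy]
  have hz1 : z ⬝ᵥ (imMat H *ᵥ z) = y ⬝ᵥ (imMat H *ᵥ y) + 2 * (y ⬝ᵥ (imMat H *ᵥ Z))
      + Z ⬝ᵥ (imMat H *ᵥ Z) := by
    rw [hz, Matrix.mulVec_add, add_dotProduct, dotProduct_add, dotProduct_add,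
      dotProduct_mulVec_symm hK Z y]
    ring
  have hz2 : z ⬝ᵥ ((reMat H * Om n) *ᵥ (G *ᵥ y)) = y ⬝ᵥ ((reMat H * Om n) *ᵥ (G *ᵥ y))
      + Z ⬝ᵥ ((reMat H * Om n) *ᵥ (G *ᵥ y)) := by
    rw [hz, add_dotProduct]
  -- transposition turns `G Ω R` into `-R Ω G`
  have hT : ∀ v : PhaseSpace n, y ⬝ᵥ (G *ᵥ ((Om n * reMat H) *ᵥ v))
      = -(v ⬝ᵥ ((reMat H * Om n) *ᵥ (G *ᵥ y))) := fun v => by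
    rw [dotProduct_mulVec_symm hG, dotProduct_comm, dotProduct_mulVec_transpose,
      Matrix.transpose_mul, hR, Om_transpose, Matrix.mul_neg, Matrix.neg_mulVec, dotProduct_neg]
  have hq : y ⬝ᵥ ((reMat H * Om n * G - imMat H + G * ((Om n)ᵀ * imMat H * Om n) * G
          - G * (Om n * reMat H)) *ᵥ y) = 2 * (y ⬝ᵥ ((reMat H * Om n) *ᵥ (G *ᵥ y)))
        - y ⬝ᵥ (imMat H *ᵥ y) + (G *ᵥ y) ⬝ᵥ (((Om n)ᵀ * imMat H * Om n) *ᵥ (G *ᵥ y)) := by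
    have h1 := hT y
    rw [Matrix.sub_mulVec, Matrix.add_mulVec, Matrix.sub_mulVec, dotProduct_sub, dotProduct_add,
      dotProduct_sub, ← Matrix.mulVec_mulVec y G (Om n * reMat H), h1,
      ← Matrix.mulVec_mulVec y _ G, ← Matrix.mulVec_mulVec y _ G,
      ← Matrix.mulVec_mulVec _ G _, dotProduct_mulVec_symm hG y,
      dotProduct_comm _ (G *ᵥ y)]
    ring
  have hl : y ⬝ᵥ (G *ᵥ ((Om n * reMat H) *ᵥ Z + (G⁻¹ * imMat H) *ᵥ Z)) =
      -(Z ⬝ᵥ ((reMat H * Om n) *ᵥ (G *ᵥ y))) + y ⬝ᵥ (imMat H *ᵥ Z) := by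
    rw [Matrix.mulVec_add, dotProduct_add, hT Z, Matrix.mulVec_mulVec Z G, ← mul_assoc,
      Matrix.mul_nonsing_inv _ hdet, one_mul]
  have htr : (imMat H * Om n * G * (Om n)ᵀ).trace = ((Om n)ᵀ * imMat H * Om n * G).trace := by
    rw [Matrix.trace_mul_comm, ← mul_assoc, ← mul_assoc]
  rw [hq, hl, hz1, htr, Matrix.mulVec_smul, dotProduct_smul, hz2, smul_eq_mul]
  field_simp
  ring

theorem IsGaussianPath.isUnit {n : ℕ} {hbar c T : ℝ} {H : ℝ → Matrix (Idx n) (Idx n) ℂ}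
    {G : ℝ → PhaseMat n} {Z : ℝ → PhaseSpace n} {β : ℝ → ℝ}
    (h : IsGaussianPath hbar c H T G Z β) {t : ℝ} (ht : t ∈ Ico 0 T) : IsUnit (G t) :=
  (posDef_of_lower_bound (h.symm t ht) h.c_pos (h.lower t ht)).isUnit

theorem IsGaussianPath.hasDerivWithinAt {n : ℕ} {hbar c T : ℝ}
    {H : ℝ → Matrix (Idx n) (Idx n) ℂ}
    {G : ℝ → PhaseMat n} {Z : ℝ → PhaseSpace n} {β : ℝ → ℝ}
    (h : IsGaussianPath hbar c H T G Z β) {t : ℝ} (ht : t ∈ Ico 0 T) (z : PhaseSpace n) :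
    HasDerivWithinAt (fun s => gaussian hbar (β s) (Z s) (G s) z)
      (1 / hbar * wignerOp hbar (H t) (gaussian hbar (β t) (Z t) (G t)) z) (Ico 0 T) t := by
  refine (hasDerivWithinAt_gaussian (h.symm t ht) (h.derivG t ht) (h.derivZ t ht)
    (h.derivβ t ht) z).congr_deriv ?_
  rw [wignerOp_gaussian h.hbar_pos.ne' (h.symm t ht) (h.isUnit ht) (h.symmH t ht.1),
    ← mul_assoc (1 / hbar), one_div_mul_cancel h.hbar_pos.ne', one_mul]

theorem IsGaussianPath.isClassicalSolution {n : ℕ} {hbar c T : ℝ}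
    {H : ℝ → Matrix (Idx n) (Idx n) ℂ}
    {G : ℝ → PhaseMat n} {Z : ℝ → PhaseSpace n} {β : ℝ → ℝ}
    (h : IsGaussianPath hbar c H T G Z β) :
    IsClassicalSolution hbar H T fun t => gaussian hbar (β t) (Z t) (G t) := fun t ht =>
  ⟨contDiff_gaussian _ _ _ _, fun z => ⟨_, h.hasDerivWithinAt ht z, by
    rw [← mul_assoc, mul_one_div_cancel h.hbar_pos.ne', one_mul]⟩⟩

/-! ### Integration by parts -/

theorem contDiff_mulVec {n : ℕ} (M : PhaseMat n) {F : PhaseSpace n → PhaseSpace n}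
    {k : WithTop ℕ∞} (hF : ContDiff ℝ k F) : ContDiff ℝ k fun y => M *ᵥ F y := by
  refine contDiff_pi.2 fun i => ?_
  simp only [Matrix.mulVec, dotProduct]
  exact ContDiff.sum fun j _ => contDiff_const.mul (contDiff_pi.1 hF j)

theorem contDiff_vecMul {n : ℕ} (M : PhaseMat n) {k : WithTop ℕ∞} :
    ContDiff ℝ k fun y : PhaseSpace n => y ᵥ* M := by
  simp only [← Matrix.mulVec_transpose]
  exact contDiff_mulVec _ contDiff_id

theorem continuous_diverg {n : ℕ} {F : PhaseSpace n → PhaseSpace n} (hF : ContDiff ℝ 1 F) :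
    Continuous (diverg F) :=
  continuous_finsetSum _ fun i _ =>
    ((contDiff_pi.1 hF i).continuous_fderiv one_ne_zero).clm_apply continuous_const

theorem continuous_lapl {n : ℕ} (K : PhaseMat n) {f : PhaseSpace n → ℝ} (hf : ContDiff ℝ 2 f) :
    Continuous (lapl K f) :=
  (continuous_diverg (contDiff_mulVec _ (contDiff_grad (k := 1) hf (by norm_num)))).neg

theorem continuous_wignerOp {n : ℕ} (hbar : ℝ) (H : Matrix (Idx n) (Idx n) ℂ)
    {f : PhaseSpace n → ℝ} (hf : ContDiff ℝ 2 f) : Continuous (wignerOp hbar H f) := by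
  have hg : Continuous (grad f) := (contDiff_grad (k := 0) hf (by norm_num)).continuous
  exact (((continuous_const.mul (continuous_lapl _ hf)).sub (continuous_const.mul
    (continuous_id.dotProduct (continuous_const.matrix_mulVec hg)))).sub
    ((continuous_id.dotProduct (continuous_const.matrix_mulVec continuous_id)).mul
      hf.continuous)).neg

theorem continuous_wignerOpTranspose {n : ℕ} (hbar : ℝ) (H : Matrix (Idx n) (Idx n) ℂ)
    {f : PhaseSpace n → ℝ} (hf : ContDiff ℝ 2 f) :
    Continuous (wignerOpTranspose hbar H f) := by
  have h1 : ContDiff ℝ 1 fun y => f y • (y ᵥ* (reMat H * Om n)) :=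
    (hf.of_le (by norm_num)).smul (contDiff_vecMul _)
  exact (((continuous_const.mul (continuous_lapl _ hf)).add (continuous_const.mul
    (continuous_diverg h1))).sub
    ((continuous_id.dotProduct (continuous_const.matrix_mulVec continuous_id)).mul
      hf.continuous)).neg

theorem fderiv_eq_zero_of_vanish {n : ℕ} {f : PhaseSpace n → ℝ} {k : Set (PhaseSpace n)}
    (hk : IsClosed k) (hf : ∀ z ∉ k, f z = 0) {z : PhaseSpace n} (hz : z ∉ k) :
    fderiv ℝ f z = 0 := by
  have h : f =ᶠ[𝓝 z] fun _ => 0 := by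
    filter_upwards [hk.isOpen_compl.mem_nhds hz] with y hy using hf y hy
  rw [h.fderiv_eq]
  exact fderiv_const_apply 0

theorem grad_eq_zero_of_vanish {n : ℕ} {f : PhaseSpace n → ℝ} {k : Set (PhaseSpace n)}
    (hk : IsClosed k) (hf : ∀ z ∉ k, f z = 0) : ∀ z ∉ k, grad f z = 0 := fun z hz => by
  funext i
  simp [grad, fderiv_eq_zero_of_vanish hk hf hz]

theorem diverg_eq_zero_of_vanish {n : ℕ} {F : PhaseSpace n → PhaseSpace n}
    {k : Set (PhaseSpace n)} (hk : IsClosed k) (hF : ∀ z ∉ k, F z = 0) :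
    ∀ z ∉ k, diverg F z = 0 := fun z hz => by
  refine Finset.sum_eq_zero fun i _ => ?_
  rw [fderiv_eq_zero_of_vanish hk (fun y hy => by rw [hF y hy]; rfl) hz]
  rfl

theorem lapl_eq_zero_of_vanish {n : ℕ} (K : PhaseMat n) {f : PhaseSpace n → ℝ}
    {k : Set (PhaseSpace n)} (hk : IsClosed k) (hf : ∀ z ∉ k, f z = 0) :
    ∀ z ∉ k, lapl K f z = 0 := fun z hz => by
  rw [lapl, diverg_eq_zero_of_vanish hk (fun y hy => ?_) z hz, neg_zero]
  rw [grad_eq_zero_of_vanish hk hf y hy, Matrix.mulVec_zero]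

theorem hasCompactSupport_wignerOpTranspose {n : ℕ} (hbar : ℝ) (H : Matrix (Idx n) (Idx n) ℂ)
    {f : PhaseSpace n → ℝ} (hf : HasCompactSupport f) :
    HasCompactSupport (wignerOpTranspose hbar H f) := by
  have h0 : ∀ z ∉ tsupport f, f z = 0 := fun z hz => image_eq_zero_of_notMem_tsupport hz
  refine HasCompactSupport.intro hf fun z hz => ?_
  rw [wignerOpTranspose, lapl_eq_zero_of_vanish _ (isClosed_tsupport f) h0 z hz,
    diverg_eq_zero_of_vanish (isClosed_tsupport f) (fun y hy => by rw [h0 y hy, zero_smul]) z hz,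
    h0 z hz]
  ring

theorem integral_diverg_eq_zero {n : ℕ} {F : PhaseSpace n → PhaseSpace n} (hF : ContDiff ℝ 1 F)
    (hc : HasCompactSupport F) : ∫ z, diverg F z = 0 := by
  have hFi := fun i => contDiff_pi.1 hF i
  have hci : ∀ i, HasCompactSupport fun z => F z i := fun i =>
    hc.comp_left (g := fun v : PhaseSpace n => v i) rfl
  have hint : ∀ i, Integrable fun z => fderiv ℝ (fun y => F y i) z (Pi.single i 1) := fun i =>
    (((hFi i).continuous_fderiv one_ne_zero).clm_apply
      continuous_const).integrable_of_hasCompactSupport ((hci i).fderiv_apply (𝕜 := ℝ) _)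
  simp only [diverg]
  rw [integral_finsetSum _ fun i _ => hint i]
  refine Finset.sum_eq_zero fun i _ => ?_
  have h := integral_mul_fderiv_eq_neg_fderiv_mul_of_integrable (μ := volume)
    (f := fun z => F z i) (g := fun _ : PhaseSpace n => (1 : ℝ)) (v := Pi.single i 1)
    (by simpa using hint i) (by simp)
    (by simpa using (hFi i).continuous.integrable_of_hasCompactSupport (hci i))
    (fun z _ => (hFi i).differentiable one_ne_zero z) (fun z _ => differentiableAt_const _)
  simpa using h.symm

/-- `wignerOpTranspose` is the formal transpose of `wignerOp`. -/
theorem integral_wignerOp_mul {n : ℕ} (hbar : ℝ) {H : Matrix (Idx n) (Idx n) ℂ} (hH : H.IsSymm)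
    {f φ : PhaseSpace n → ℝ} (hf : ContDiff ℝ 2 f) (hφ : ContDiff ℝ 2 φ)
    (hc : HasCompactSupport φ) :
    ∫ z, wignerOp hbar H f z * φ z = ∫ z, f z * wignerOpTranspose hbar H φ z := by
  have hfd : Differentiable ℝ f := hf.differentiable two_ne_zero
  have hφd : Differentiable ℝ φ := hφ.differentiable two_ne_zero
  set S := (Om n)ᵀ * imMat H * Om n with hS
  have hgf := contDiff_mulVec S (contDiff_grad (k := 1) hf (by norm_num))
  have hgφ := contDiff_mulVec S (contDiff_grad (k := 1) hφ (by norm_num))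
  have hv : ContDiff ℝ 1 fun y : PhaseSpace n => y ᵥ* (reMat H * Om n) := contDiff_vecMul _
  have hf1 : ContDiff ℝ 1 f := hf.of_le (by norm_num)
  have hφ1 : ContDiff ℝ 1 φ := hφ.of_le (by norm_num)
  -- the difference of the two integrands is the divergence of this field
  set F : PhaseSpace n → PhaseSpace n := fun y =>
    ((-(hbar ^ 2 / 4)) * φ y) • (S *ᵥ grad f y) + ((hbar ^ 2 / 4 * f y) • (S *ᵥ grad φ y)
      + (hbar * f y) • (φ y • (y ᵥ* (reMat H * Om n)))) with hFdef
  have hF : ContDiff ℝ 1 F := ((contDiff_const.mul hφ1).smul hgf).add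
    (((contDiff_const.mul hf1).smul hgφ).add ((contDiff_const.mul hf1).smul (hφ1.smul hv)))
  have h0 : ∀ z ∉ tsupport φ, φ z = 0 := fun z hz => image_eq_zero_of_notMem_tsupport hz
  have hFc : HasCompactSupport F := by
    refine HasCompactSupport.intro hc fun z hz => ?_
    simp only [hFdef, h0 z hz, grad_eq_zero_of_vanish (isClosed_tsupport φ) h0 z hz,
      Matrix.mulVec_zero, mul_zero, zero_smul, smul_zero, add_zero]
  have hdiv : ∀ z, diverg F z = wignerOp hbar H f z * φ z
      - f z * wignerOpTranspose hbar H φ z := fun z => by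
    have d1 := hgf.differentiable one_ne_zero z
    have d2 := hgφ.differentiable one_ne_zero z
    have d3 := hv.differentiable one_ne_zero z
    rw [hFdef, diverg_add (((hφd z).const_mul _).fun_smul d1)
        ((((hfd z).const_mul _).fun_smul d2).fun_add
          (((hfd z).const_mul _).fun_smul ((hφd z).fun_smul d3))),
      diverg_add (((hfd z).const_mul _).fun_smul d2)
        (((hfd z).const_mul _).fun_smul ((hφd z).fun_smul d3)),
      diverg_smul ((hφd z).const_mul _) d1, diverg_smul ((hfd z).const_mul _) d2,
      diverg_smul ((hfd z).const_mul _) ((hφd z).fun_smul d3), grad_const_mul _ (hφd z),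
      grad_const_mul _ (hfd z), grad_const_mul _ (hfd z), wignerOp, wignerOpTranspose, lapl, lapl,
      smul_dotProduct, smul_dotProduct, smul_dotProduct, dotProduct_smul,
      dotProduct_mulVec_symm (conj_Om_isSymm (imMat_isSymm hH)) (grad φ z),
      Matrix.dotProduct_mulVec z (reMat H * Om n), dotProduct_comm (grad f z) (z ᵥ* _)]
    simp only [smul_eq_mul]
    ring
  have h := integral_diverg_eq_zero hF hFc
  simp only [hdiv] at h
  rw [integral_sub] at h
  · exact sub_eq_zero.1 h
  · exact ((continuous_wignerOp hbar H hf).mul hφ.continuous).integrable_of_hasCompactSupport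
      hc.mul_left
  · exact (hf.continuous.mul
      (continuous_wignerOpTranspose hbar H hφ)).integrable_of_hasCompactSupport
      (hasCompactSupport_wignerOpTranspose hbar H hc).mul_left

/-! ### Pairings in `L²` -/

theorem enorm_integral_mul_le {X : Type*} [MeasurableSpace X] {μ : Measure X} {f g : X → ℝ}
    (hf : MemLp f 2 μ) (hg : MemLp g 2 μ) :
    ‖∫ x, f x * g x ∂μ‖ₑ ≤ eLpNorm f 2 μ * eLpNorm g 2 μ := by
  refine (enorm_integral_le_lintegral_enorm _).trans ?_
  rw [← eLpNorm_one_eq_lintegral_enorm]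
  have : ENNReal.HolderTriple 2 2 1 := inferInstance
  change eLpNorm (f • g) 1 μ ≤ _
  exact eLpNorm_smul_le_mul_eLpNorm hg.1 hf.1

theorem integrable_mul_of_memLp {X : Type*} [MeasurableSpace X] {μ : Measure X} {f g : X → ℝ}
    (hf : MemLp f 2 μ) (hg : MemLp g 2 μ) : Integrable (fun x => f x * g x) μ :=
  hf.integrable_mul hg

/-- Differentiation of the pairing of a moving `L²` function `V` with a moving test function `ψ`
that is Lipschitz in time with an `L²` constant. -/
theorem hasDerivWithinAt_integral_mul {X : Type*} [MeasurableSpace X] {μ : Measure X} {S : Set ℝ}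
    {t : ℝ} (ht : t ∈ S) {V ψ : ℝ → X → ℝ} {ψ' g : X → ℝ} {d : ℝ}
    (hV : ∀ s ∈ S, MemLp (V s) 2 μ)
    (hVc : Tendsto (fun s => eLpNorm (V s - V t) 2 μ) (𝓝[S] t) (𝓝 0))
    (hψ : ∀ s ∈ S, MemLp (ψ s) 2 μ) (hg : MemLp g 2 μ)
    (hψg : ∀ s ∈ S, ∀ x, |ψ s x - ψ t x| ≤ |s - t| * g x)
    (hψ' : ∀ x, HasDerivWithinAt (fun s => ψ s x) (ψ' x) S t)
    (hd : HasDerivWithinAt (fun s => ∫ x, V s x * ψ t x ∂μ) d S t) :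
    HasDerivWithinAt (fun s => ∫ x, V s x * ψ s x ∂μ) (d + ∫ x, V t x * ψ' x ∂μ) S t := by
  have hsplit : ∀ s ∈ S, ∫ x, V s x * ψ s x ∂μ
      = (∫ x, V s x * ψ t x ∂μ) + ∫ x, V s x * (ψ s x - ψ t x) ∂μ := fun s hs => by
    have h := integrable_mul_of_memLp (hV s hs) ((hψ s hs).sub (hψ t ht))
    simp only [Pi.sub_apply] at h
    rw [← integral_add (integrable_mul_of_memLp (hV s hs) (hψ t ht)) h]
    refine integral_congr_ae (ae_of_all _ fun x => ?_)
    ring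
  refine HasDerivWithinAt.congr (hd.add ?_) hsplit (hsplit t ht)
  rw [hasDerivWithinAt_iff_tendsto_slope]
  set q : ℝ → X → ℝ := fun s x => (s - t)⁻¹ * (ψ s x - ψ t x) with hq
  have hqm : ∀ s ∈ S, MemLp (q s) 2 μ := fun s hs => ((hψ s hs).sub (hψ t ht)).const_mul _
  have hqg : ∀ s ∈ S \ {t}, ∀ x, ‖q s x‖ ≤ g x := fun s hs x => by
    have h0 : 0 < |s - t| := abs_pos.2 (sub_ne_zero.2 hs.2)
    rw [hq, Real.norm_eq_abs, abs_mul, abs_inv, inv_mul_le_iff₀ h0]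
    exact hψg s hs.1 x
  have h1 : Tendsto (fun s => ∫ x, V t x * q s x ∂μ) (𝓝[S \ {t}] t)
      (𝓝 (∫ x, V t x * ψ' x ∂μ)) := by
    refine tendsto_integral_filter_of_dominated_convergence (fun x => ‖V t x‖ * g x) ?_ ?_ ?_ ?_
    · filter_upwards [self_mem_nhdsWithin] with s hs
      exact (hV t ht).1.mul (hqm s hs.1).1
    · filter_upwards [self_mem_nhdsWithin] with s hs
      refine ae_of_all _ fun x => ?_
      rw [norm_mul]
      gcongr
      exact hqg s hs x
    · exact integrable_mul_of_memLp (hV t ht).norm hg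
    · refine ae_of_all _ fun x => Tendsto.const_mul _ ?_
      exact hasDerivWithinAt_iff_tendsto_slope.1 (hψ' x)
  have h2 : Tendsto (fun s => ∫ x, (V s - V t) x * q s x ∂μ) (𝓝[S \ {t}] t) (𝓝 0) := by
    rw [tendsto_zero_iff_enorm_tendsto_zero]
    have h3 : Tendsto (fun s => eLpNorm (V s - V t) 2 μ * eLpNorm g 2 μ) (𝓝[S \ {t}] t) (𝓝 0) := by
      have := ENNReal.Tendsto.mul_const (b := eLpNorm g 2 μ)
        (hVc.mono_left (nhdsWithin_mono t (sdiff_subset : S \ {t} ⊆ S))) (Or.inr hg.2.ne)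
      simpa using this
    refine tendsto_of_tendsto_of_tendsto_of_le_of_le' tendsto_const_nhds h3
      (Eventually.of_forall fun _ => zero_le) ?_
    filter_upwards [self_mem_nhdsWithin] with s hs
    refine (enorm_integral_mul_le ((hV s hs.1).sub (hV t ht)) (hqm s hs.1)).trans ?_
    gcongr
    exact eLpNorm_mono_real (hqg s hs)
  have h3 := h2.add h1
  rw [zero_add] at h3
  refine h3.congr' ?_
  filter_upwards [self_mem_nhdsWithin] with s hs
  rw [← integral_add (integrable_mul_of_memLp ((hV s hs.1).sub (hV t ht)) (hqm s hs.1))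
    (integrable_mul_of_memLp (hV t ht) (hqm s hs.1))]
  simp only [slope, sub_self, mul_zero, integral_zero, vsub_eq_sub, sub_zero, smul_eq_mul,
    Pi.sub_apply]
  rw [← integral_const_mul]
  refine integral_congr_ae (ae_of_all _ fun x => ?_)
  simp only [hq]
  ring

theorem memLp_exp_neg_mul_norm_sq {n : ℕ} {a : ℝ} (ha : 0 < a) :
    MemLp (fun z : PhaseSpace n => Real.exp (-a * ‖z‖ ^ 2)) 2 volume := by
  have hcont : Continuous fun z : PhaseSpace n => Real.exp (-a * ‖z‖ ^ 2) := by fun_prop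
  rw [memLp_two_iff_integrable_sq hcont.aestronglyMeasurable]
  set N : ℝ := (Fintype.card (Idx n) : ℝ) with hN
  have hN0 : 0 ≤ N := by positivity
  have hint : Integrable fun z : PhaseSpace n => ∏ i, Real.exp (-(2 * a / (N + 1)) * z i ^ 2) :=
    Integrable.fintype_prod (f := fun (_ : Idx n) x => Real.exp (-(2 * a / (N + 1)) * x ^ 2))
      fun i => integrable_exp_neg_mul_sq (by positivity)
  refine hint.mono' (hcont.pow 2).aestronglyMeasurable (ae_of_all _ fun z => ?_)
  rw [Real.norm_eq_abs, abs_of_nonneg (by positivity), ← Real.exp_sum, ← Real.exp_nat_mul]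
  refine Real.exp_le_exp.2 ?_
  rw [← Finset.mul_sum]
  have h1 : ∑ i, z i ^ 2 ≤ N * ‖z‖ ^ 2 := by
    calc ∑ i, z i ^ 2 ≤ ∑ _i : Idx n, ‖z‖ ^ 2 := by
          refine Finset.sum_le_sum fun i _ => ?_
          rw [← sq_abs]
          have : |z i| ≤ ‖z‖ := norm_le_pi_norm z i
          gcongr
      _ = N * ‖z‖ ^ 2 := by simp [hN]
  have h2 : 2 * a / (N + 1) * ∑ i, z i ^ 2 ≤ 2 * a * ‖z‖ ^ 2 := by
    rw [div_mul_eq_mul_div, div_le_iff₀ (by positivity)]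
    have : 0 ≤ a * ‖z‖ ^ 2 := by positivity
    nlinarith
  push_cast
  linarith

/-! ### Gaussian domination and the `L²` solution -/

theorem gaussian_pos {n : ℕ} {hbar : ℝ} (hbar0 : 0 < hbar) (b : ℝ) (Z : PhaseSpace n)
    (G : PhaseMat n) (z : PhaseSpace n) : 0 < gaussian hbar b Z G z := by
  have := Real.pi_pos
  unfold gaussian
  positivity

/-- A Gaussian with bounded parameters lies below a fixed centred Gaussian of half the decay
rate. -/
theorem gaussian_le {n : ℕ} {hbar c B b : ℝ} (hbar0 : 0 < hbar) (hc : 0 < c) {Z : PhaseSpace n}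
    {G : PhaseMat n} (hG : ∀ z : PhaseSpace n, c * ‖z‖ ^ 2 ≤ z ⬝ᵥ (G *ᵥ z)) (hb : |b| ≤ B)
    (hZ : ‖Z‖ ≤ B) (z : PhaseSpace n) :
    gaussian hbar b Z G z ≤ Real.exp B / (Real.pi * hbar) ^ n * Real.exp (c / hbar * B ^ 2)
      * Real.exp (-(c / (2 * hbar)) * ‖z‖ ^ 2) := by
  have hpi := Real.pi_pos
  rw [gaussian, mul_assoc, ← Real.exp_add]
  gcongr
  · exact (neg_le_abs b).trans hb
  · have h1 : ‖z‖ ≤ ‖z - Z‖ + B := by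
      calc ‖z‖ = ‖(z - Z) + Z‖ := by rw [sub_add_cancel]
        _ ≤ ‖z - Z‖ + B := (norm_add_le _ _).trans (by gcongr)
    have h2 : ‖z‖ ^ 2 ≤ 2 * ‖z - Z‖ ^ 2 + 2 * B ^ 2 := by
      have : ‖z‖ ^ 2 ≤ (‖z - Z‖ + B) ^ 2 := by gcongr
      nlinarith [sq_nonneg (‖z - Z‖ - B)]
    have h3 := hG (z - Z)
    have h4 : c * ‖z‖ ^ 2 ≤ 2 * ((z - Z) ⬝ᵥ (G *ᵥ (z - Z))) + 2 * c * B ^ 2 := by nlinarith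
    have h5 : c / hbar * B ^ 2 + -(c / (2 * hbar)) * ‖z‖ ^ 2
        - -(1 / hbar) * ((z - Z) ⬝ᵥ (G *ᵥ (z - Z)))
        = (2 * ((z - Z) ⬝ᵥ (G *ᵥ (z - Z))) + 2 * c * B ^ 2 - c * ‖z‖ ^ 2) / (2 * hbar) := by
      field_simp
      ring
    have h6 : 0 ≤ (2 * ((z - Z) ⬝ᵥ (G *ᵥ (z - Z))) + 2 * c * B ^ 2 - c * ‖z‖ ^ 2)
        / (2 * hbar) := div_nonneg (by linarith) (by positivity)
    linarith

theorem one_add_sq_mul_exp_le {a : ℝ} (ha : 0 < a) (x : ℝ) :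
    (1 + x) ^ 2 * Real.exp (-(2 * a) * x ^ 2) ≤ (2 + 2 / a) * Real.exp (-a * x ^ 2) := by
  have h1 : Real.exp (-(2 * a) * x ^ 2) = Real.exp (-a * x ^ 2) * Real.exp (-a * x ^ 2) := by
    rw [← Real.exp_add]
    ring_nf
  rw [h1, ← mul_assoc]
  gcongr
  have h2 : a * x ^ 2 + 1 ≤ Real.exp (a * x ^ 2) := Real.add_one_le_exp _
  have h3 : Real.exp (-a * x ^ 2) = (Real.exp (a * x ^ 2))⁻¹ := by
    rw [← Real.exp_neg]
    ring_nf
  rw [h3, ← div_eq_mul_inv, div_le_iff₀ (Real.exp_pos _)]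
  have h4 : (1 + x) ^ 2 ≤ (2 + 2 / a) * (a * x ^ 2 + 1) := by
    have : (2 + 2 / a) * (a * x ^ 2 + 1) = 2 * a * x ^ 2 + 2 + 2 * x ^ 2 + 2 / a := by
      field_simp
      ring
    rw [this]
    have : 0 < 2 / a := by positivity
    nlinarith [sq_nonneg (1 - x), mul_nonneg ha.le (sq_nonneg x)]
  exact h4.trans (by gcongr)

theorem exists_entry_bound {l m : Type*} [Fintype l] [Fintype m] {M : ℝ → Matrix l m ℝ}
    {S : Set ℝ} (hS : IsCompact S) (hM : ContinuousOn M S) :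
    ∃ B, ∀ s ∈ S, ∀ i j, |M s i j| ≤ B := by
  have hM' : ContinuousOn (fun s => (fun i j => M s i j : l → m → ℝ)) S := hM
  obtain ⟨B, hB⟩ := hS.exists_bound_of_continuousOn hM'
  exact ⟨B, fun s hs i j => (norm_le_pi_norm (fun j => M s i j) j).trans
    ((norm_le_pi_norm (fun i j => M s i j) i).trans (hB s hs))⟩

theorem abs_gaussianRate_le {n : ℕ} {hbar B : ℝ} (hbar0 : 0 < hbar) (hB : 1 ≤ B)
    {G G' : PhaseMat n} {Z Z' : PhaseSpace n} {b' : ℝ} (hG : ∀ i j, |G i j| ≤ B)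
    (hG' : ∀ i j, |G' i j| ≤ B) (hZ : ‖Z‖ ≤ B) (hZ' : ‖Z'‖ ≤ B) (hb' : |b'| ≤ B)
    (z : PhaseSpace n) :
    |gaussianRate hbar G G' Z Z' b' z| ≤
      (B + 1 / hbar * (3 * (Fintype.card (Idx n) : ℝ) ^ 2 * B ^ 3)) * (1 + ‖z‖) ^ 2 := by
  set N : ℝ := (Fintype.card (Idx n) : ℝ) ^ 2 with hN
  have hN0 : 0 ≤ N := by positivity
  have hz := norm_nonneg z
  set w := 1 + ‖z‖ with hw
  have hw1 : 1 ≤ w := by linarith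
  have hy : ‖z - Z‖ ≤ B * w := by
    have : ‖z - Z‖ ≤ ‖z‖ + B := (norm_sub_le _ _).trans (by gcongr)
    nlinarith
  have h1 : |(z - Z) ⬝ᵥ (G' *ᵥ (z - Z))| ≤ N * B ^ 3 * w ^ 2 :=
    calc _ ≤ N * B * (‖z - Z‖ * ‖z - Z‖) := abs_dotProduct_mulVec_le hG' _ _
      _ ≤ N * B * ((B * w) * (B * w)) := by gcongr
      _ = N * B ^ 3 * w ^ 2 := by ring
  have h2 : |(z - Z) ⬝ᵥ (G *ᵥ Z')| ≤ N * B ^ 3 * w ^ 2 :=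
    calc _ ≤ N * B * (‖z - Z‖ * ‖Z'‖) := abs_dotProduct_mulVec_le hG _ _
      _ ≤ N * B * ((B * w) * (B * w)) := by
          gcongr
          nlinarith
      _ = N * B ^ 3 * w ^ 2 := by ring
  have h3 : |b'| ≤ B * w ^ 2 :=
    hb'.trans (le_mul_of_one_le_right (by linarith) (one_le_pow₀ hw1))
  have h4 : |(z - Z) ⬝ᵥ (G' *ᵥ (z - Z)) - 2 * ((z - Z) ⬝ᵥ (G *ᵥ Z'))| ≤ 3 * N * B ^ 3 * w ^ 2 := by
    rw [abs_le] at h1 h2 ⊢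
    constructor <;> linarith [h1.1, h1.2, h2.1, h2.2]
  rw [gaussianRate]
  calc _ ≤ |-b'| + |1 / hbar * ((z - Z) ⬝ᵥ (G' *ᵥ (z - Z)) - 2 * ((z - Z) ⬝ᵥ (G *ᵥ Z')))| :=
        abs_sub _ _
    _ ≤ B * w ^ 2 + 1 / hbar * (3 * N * B ^ 3 * w ^ 2) := by
        rw [abs_neg, abs_mul, abs_of_pos (show 0 < 1 / hbar by positivity)]
        gcongr
    _ = _ := by ring

theorem norm_grad_gaussian_le {n : ℕ} {hbar B b : ℝ} (hbar0 : 0 < hbar) (hB : 1 ≤ B)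
    {G : PhaseMat n} {Z : PhaseSpace n} (hGs : Gᵀ = G) (hG : ∀ i j, |G i j| ≤ B)
    (hZ : ‖Z‖ ≤ B) (z : PhaseSpace n) :
    ‖grad (gaussian hbar b Z G) z‖ ≤ 2 / hbar * (Fintype.card (Idx n) * B ^ 2) *
      ((1 + ‖z‖) ^ 2 * gaussian hbar b Z G z) := by
  have hpos := gaussian_pos hbar0 b Z G z
  have hz := norm_nonneg z
  have hy : ‖z - Z‖ ≤ B * (1 + ‖z‖) ^ 2 := by
    have h1 : ‖z - Z‖ ≤ ‖z‖ + B := (norm_sub_le _ _).trans (by gcongr)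
    have h2 : ‖z‖ + B ≤ B * (1 + ‖z‖) := by nlinarith
    have h3 : B * (1 + ‖z‖) ≤ B * (1 + ‖z‖) ^ 2 := by
      gcongr
      exact le_self_pow₀ (by linarith) two_ne_zero
    linarith
  have h1 : ‖G *ᵥ (z - Z)‖ ≤ Fintype.card (Idx n) * B * ‖z - Z‖ :=
    norm_mulVec_le (by positivity) (fun i =>
      (Finset.sum_le_sum fun j _ => hG i j).trans (by simp)) _
  rw [grad_gaussian hbar b Z hGs, norm_smul, Real.norm_eq_abs, abs_mul, abs_neg,
    abs_of_pos hpos, abs_of_pos (show 0 < 2 / hbar by positivity)]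
  calc _ ≤ 2 / hbar * gaussian hbar b Z G z *
        (Fintype.card (Idx n) * B * (B * (1 + ‖z‖) ^ 2)) := by gcongr; exact h1.trans (by gcongr)
    _ = _ := by ring

section MovingGaussian

variable {n : ℕ} {hbar c T : ℝ} {H : ℝ → Matrix (Idx n) (Idx n) ℂ} {G : ℝ → PhaseMat n}
  {Z : ℝ → PhaseSpace n} {β : ℝ → ℝ}

theorem IsGaussianPath.continuousOn_G (h : IsGaussianPath hbar c H T G Z β) :
    ContinuousOn G (Ico 0 T) := fun t ht =>
  continuousWithinAt_matrix fun i j => (h.derivG t ht i j).continuousWithinAt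

theorem IsGaussianPath.continuousOn_Z (h : IsGaussianPath hbar c H T G Z β) :
    ContinuousOn Z (Ico 0 T) := fun t ht => (h.derivZ t ht).continuousWithinAt

/-- On compact time intervals a moving Gaussian, its gradient and its time derivative are dominated
by one fixed Gaussian. -/
theorem IsGaussianPath.exists_dominated (h : IsGaussianPath hbar c H T G Z β) {b : ℝ}
    (hb : b < T) :
    ∃ a > 0, ∃ C > 0, ∀ s ∈ Icc 0 b, ∀ z : PhaseSpace n,
      (1 + ‖z‖) ^ 2 * gaussian hbar (β s) (Z s) (G s) z ≤ C * Real.exp (-a * ‖z‖ ^ 2) ∧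
      ‖grad (gaussian hbar (β s) (Z s) (G s)) z‖ ≤ C * Real.exp (-a * ‖z‖ ^ 2) ∧
      |1 / hbar * wignerOp hbar (H s) (gaussian hbar (β s) (Z s) (G s)) z|
        ≤ C * Real.exp (-a * ‖z‖ ^ 2) := by
  have hh := h.hbar_pos
  have hc := h.c_pos
  have hpi := Real.pi_pos
  have hsub : Icc 0 b ⊆ Ico 0 T := fun s hs => ⟨hs.1, hs.2.trans_lt hb⟩
  have cG := h.continuousOn_G.mono hsub
  have cZ := h.continuousOn_Z.mono hsub
  have cβ : ContinuousOn β (Icc 0 b) := fun t ht =>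
    (h.derivβ t (hsub ht)).continuousWithinAt.mono hsub
  have cH : ContinuousOn H (Icc 0 b) := h.contH.mono Icc_subset_Ici_self
  have cR : ContinuousOn (fun t => reMat (H t)) (Icc 0 b) := continuous_reMat.comp_continuousOn cH
  have cK : ContinuousOn (fun t => imMat (H t)) (Icc 0 b) := continuous_imMat.comp_continuousOn cH
  have cGi : ContinuousOn (fun t => (G t)⁻¹) (Icc 0 b) := fun t ht =>
    (continuousAt_matrix_inv (h.isUnit (hsub ht))).comp_continuousWithinAt (cG t ht)
  have cG' : ContinuousOn (fun t => reMat (H t) * Om n * G t - imMat (H t)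
      + G t * ((Om n)ᵀ * imMat (H t) * Om n) * G t - G t * (Om n * reMat (H t))) (Icc 0 b) := by
    rw [continuousOn_iff_continuous_domRestrict] at *
    exact ((((cR.matrix_mul continuous_const).matrix_mul cG).sub cK).add ((cG.matrix_mul
      ((continuous_const.matrix_mul cK).matrix_mul continuous_const)).matrix_mul cG)).sub
      (cG.matrix_mul (continuous_const.matrix_mul cR))
  have cZ' : ContinuousOn (fun t => (Om n * reMat (H t)) *ᵥ Z t
      + ((G t)⁻¹ * imMat (H t)) *ᵥ Z t) (Icc 0 b) := by
    rw [continuousOn_iff_continuous_domRestrict] at *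
    exact ((continuous_const.matrix_mul cR).matrix_mulVec cZ).add
      ((cGi.matrix_mul cK).matrix_mulVec cZ)
  have cβ' : ContinuousOn (fun t => -(1 / hbar) * (Z t ⬝ᵥ (imMat (H t) *ᵥ Z t))
      - 1 / 2 * (imMat (H t) * Om n * G t * (Om n)ᵀ).trace) (Icc 0 b) := by
    rw [continuousOn_iff_continuous_domRestrict] at *
    exact (continuous_const.mul (cZ.dotProduct (cK.matrix_mulVec cZ))).sub (continuous_const.mul
      (((cK.matrix_mul continuous_const).matrix_mul cG).matrix_mul
        continuous_const).matrix_trace)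
  obtain ⟨B1, hB1⟩ := exists_entry_bound isCompact_Icc cG
  obtain ⟨B2, hB2⟩ := exists_entry_bound isCompact_Icc cG'
  obtain ⟨B3, hB3⟩ := isCompact_Icc.exists_bound_of_continuousOn cZ
  obtain ⟨B4, hB4⟩ := isCompact_Icc.exists_bound_of_continuousOn cZ'
  obtain ⟨B5, hB5⟩ := isCompact_Icc.exists_bound_of_continuousOn cβ
  obtain ⟨B6, hB6⟩ := isCompact_Icc.exists_bound_of_continuousOn cβ'
  obtain ⟨B, hB, hBm⟩ : ∃ B, 1 ≤ B ∧ ∀ x ∈ [B1, B2, B3, B4, B5, B6], x ≤ B := by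
    refine ⟨1 + (|B1| + |B2| + |B3| + |B4| + |B5| + |B6|), ?_, ?_⟩
    · linarith [abs_nonneg B1, abs_nonneg B2, abs_nonneg B3, abs_nonneg B4, abs_nonneg B5,
        abs_nonneg B6]
    · simp only [List.forall_mem_cons, List.not_mem_nil, false_imp_iff, implies_true, and_true]
      refine ⟨?_, ?_, ?_, ?_, ?_, ?_⟩ <;> linarith [abs_nonneg B1, abs_nonneg B2, abs_nonneg B3,
        abs_nonneg B4, abs_nonneg B5, abs_nonneg B6, le_abs_self B1, le_abs_self B2,
        le_abs_self B3, le_abs_self B4, le_abs_self B5, le_abs_self B6]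
  simp only [List.forall_mem_cons, List.not_mem_nil, false_imp_iff, implies_true, and_true] at hBm
  obtain ⟨b1, b2, b3, b4, b5, b6⟩ := hBm
  set a : ℝ := c / (4 * hbar) with ha
  have ha0 : 0 < a := by positivity
  set C₀ : ℝ := Real.exp B / (Real.pi * hbar) ^ n * Real.exp (c / hbar * B ^ 2) * (2 + 2 / a)
    with hC₀
  have hC₀0 : 0 < C₀ := by positivity
  set C₁ : ℝ := 2 / hbar * (Fintype.card (Idx n) * B ^ 2) with hC₁
  have hC₁0 : 0 ≤ C₁ := by positivity
  set C₂ : ℝ := B + 1 / hbar * (3 * (Fintype.card (Idx n) : ℝ) ^ 2 * B ^ 3) with hC₂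
  have hC₂0 : 0 ≤ C₂ := by positivity
  refine ⟨a, ha0, (1 + C₁ + C₂) * C₀, by positivity, fun s hs z => ?_⟩
  have hpos := gaussian_pos hh (β s) (Z s) (G s) z
  have hE := Real.exp_pos (-a * ‖z‖ ^ 2)
  have key : (1 + ‖z‖) ^ 2 * gaussian hbar (β s) (Z s) (G s) z
      ≤ C₀ * Real.exp (-a * ‖z‖ ^ 2) := by
    have h1 := gaussian_le hh hc (h.lower s (hsub hs)) ((hB5 s hs).trans b5)
      ((hB3 s hs).trans b3) z
    rw [show c / (2 * hbar) = 2 * a by rw [ha]; field_simp; ring] at h1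
    calc _ ≤ (1 + ‖z‖) ^ 2 * (Real.exp B / (Real.pi * hbar) ^ n * Real.exp (c / hbar * B ^ 2)
          * Real.exp (-(2 * a) * ‖z‖ ^ 2)) := by gcongr
      _ = Real.exp B / (Real.pi * hbar) ^ n * Real.exp (c / hbar * B ^ 2)
          * ((1 + ‖z‖) ^ 2 * Real.exp (-(2 * a) * ‖z‖ ^ 2)) := by ring
      _ ≤ Real.exp B / (Real.pi * hbar) ^ n * Real.exp (c / hbar * B ^ 2)
          * ((2 + 2 / a) * Real.exp (-a * ‖z‖ ^ 2)) := by
          gcongr _ * ?_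
          exact one_add_sq_mul_exp_le ha0 _
      _ = _ := by ring
  have hX : 0 < C₀ * Real.exp (-a * ‖z‖ ^ 2) := by positivity
  refine ⟨?_, ?_, ?_⟩
  · nlinarith
  · have h1 := norm_grad_gaussian_le (b := β s) hh hB (h.symm s (hsub hs))
      (fun i j => (hB1 s hs i j).trans b1) ((hB3 s hs).trans b3) z
    have h2 : C₁ * ((1 + ‖z‖) ^ 2 * gaussian hbar (β s) (Z s) (G s) z)
        ≤ C₁ * (C₀ * Real.exp (-a * ‖z‖ ^ 2)) := by gcongr
    nlinarith
  · rw [wignerOp_gaussian hh.ne' (h.symm s (hsub hs)) (h.isUnit (hsub hs)) (h.symmH s hs.1),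
      ← mul_assoc, one_div_mul_cancel hh.ne', one_mul, abs_mul, abs_of_pos hpos]
    have h1 := abs_gaussianRate_le hh hB (fun i j => (hB1 s hs i j).trans b1)
      (fun i j => (hB2 s hs i j).trans b2) ((hB3 s hs).trans b3) ((hB4 s hs).trans b4)
      ((hB6 s hs).trans b6) z
    have h2 : gaussian hbar (β s) (Z s) (G s) z * (C₂ * (1 + ‖z‖) ^ 2)
        ≤ C₂ * (C₀ * Real.exp (-a * ‖z‖ ^ 2)) := by
      calc _ = C₂ * ((1 + ‖z‖) ^ 2 * gaussian hbar (β s) (Z s) (G s) z) := by ring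
        _ ≤ _ := by gcongr
    refine (mul_le_mul_of_nonneg_left h1 hpos.le).trans (h2.trans ?_)
    nlinarith

theorem IsGaussianPath.abs_sub_le (h : IsGaussianPath hbar c H T G Z β) {b : ℝ} (hb : b < T)
    {z : PhaseSpace n} {C : ℝ} (hC : ∀ s ∈ Icc 0 b,
      |1 / hbar * wignerOp hbar (H s) (gaussian hbar (β s) (Z s) (G s)) z| ≤ C) {s t : ℝ}
    (hs : s ∈ Icc 0 b) (ht : t ∈ Icc 0 b) :
    |gaussian hbar (β s) (Z s) (G s) z - gaussian hbar (β t) (Z t) (G t) z| ≤ |s - t| * C := by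
  have hsub : Icc 0 b ⊆ Ico 0 T := fun s hs => ⟨hs.1, hs.2.trans_lt hb⟩
  have := (convex_Icc 0 b).norm_image_sub_le_of_norm_hasDerivWithin_le
    (fun s hs => (h.hasDerivWithinAt (hsub hs) z).mono hsub) hC ht hs
  rw [mul_comm]
  exact this

theorem IsGaussianPath.memLp (h : IsGaussianPath hbar c H T G Z β) {t : ℝ} (ht : t ∈ Ico 0 T) :
    MemLp (gaussian hbar (β t) (Z t) (G t)) 2 volume := by
  obtain ⟨a, ha, C, hC, hdom⟩ := h.exists_dominated ht.2
  refine ((memLp_exp_neg_mul_norm_sq ha).const_mul C).of_le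
    (contDiff_gaussian _ _ _ _ (k := 0)).continuous.aestronglyMeasurable (ae_of_all _ fun z => ?_)
  have hpos := gaussian_pos h.hbar_pos (β t) (Z t) (G t) z
  rw [Real.norm_eq_abs, Real.norm_eq_abs, abs_of_pos hpos, abs_of_pos (by positivity)]
  refine le_trans ?_ (hdom t ⟨ht.1, le_rfl⟩ z).1
  exact le_mul_of_one_le_left hpos.le (one_le_pow₀ (by linarith [norm_nonneg z]))

theorem Icc_mem_nhdsWithin_Ico {t b T : ℝ} (htb : t < b) : Icc 0 b ∈ 𝓝[Ico 0 T] t := by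
  rw [mem_nhdsWithin]
  exact ⟨Iio b, isOpen_Iio, htb, fun s hs => ⟨hs.2.1, le_of_lt hs.1⟩⟩

theorem IsGaussianPath.isL2Solution (h : IsGaussianPath hbar c H T G Z β) :
    IsL2Solution hbar H T fun t => gaussian hbar (β t) (Z t) (G t) := by
  refine ⟨fun t ht => h.memLp ht, fun t ht => ?_, fun φ hφ hφc t ht => ?_⟩
  · obtain ⟨b, htb, hbT⟩ := exists_between ht.2
    obtain ⟨a, ha, C, hC, hdom⟩ := h.exists_dominated hbT
    set g : PhaseSpace n → ℝ := fun z => C * Real.exp (-a * ‖z‖ ^ 2) with hg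
    have hgL : MemLp g 2 volume := (memLp_exp_neg_mul_norm_sq ha).const_mul C
    have hle : ∀ᶠ s in 𝓝[Ico 0 T] t, eLpNorm (gaussian hbar (β s) (Z s) (G s)
        - gaussian hbar (β t) (Z t) (G t)) 2 volume
        ≤ ENNReal.ofReal |s - t| * eLpNorm g 2 volume := by
      filter_upwards [Icc_mem_nhdsWithin_Ico htb] with s hs
      refine eLpNorm_le_mul_eLpNorm_of_ae_le_mul (ae_of_all _ fun z => ?_) 2
      rw [Real.norm_eq_abs, Real.norm_eq_abs, Pi.sub_apply,
        abs_of_pos (show 0 < g z by positivity)]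
      exact h.abs_sub_le hbT (fun r hr => (hdom r hr z).2.2) hs ⟨ht.1, htb.le⟩
    have hlim : Tendsto (fun s => ENNReal.ofReal |s - t| * eLpNorm g 2 volume) (𝓝[Ico 0 T] t)
        (𝓝 0) := by
      have h0 : Tendsto (fun s : ℝ => ENNReal.ofReal |s - t|) (𝓝 t) (𝓝 0) := by
        have : Continuous fun s : ℝ => ENNReal.ofReal |s - t| :=
          ENNReal.continuous_ofReal.comp (continuous_id.sub continuous_const).abs
        simpa using this.tendsto t
      have := ENNReal.Tendsto.mul_const (b := eLpNorm g 2 volume)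
        (h0.mono_left (nhdsWithin_le_nhds (s := Ico 0 T))) (Or.inr hgL.2.ne)
      simpa using this
    exact tendsto_of_tendsto_of_tendsto_of_le_of_le' tendsto_const_nhds hlim
      (Eventually.of_forall fun _ => zero_le) hle
  · obtain ⟨b, htb, hbT⟩ := exists_between ht.2
    obtain ⟨a, ha, C, hC, hdom⟩ := h.exists_dominated hbT
    have hsub : Icc 0 b ⊆ Ico 0 T := fun s hs => ⟨hs.1, hs.2.trans_lt hbT⟩
    have htI : t ∈ Icc 0 b := ⟨ht.1, htb.le⟩
    have hφL : MemLp φ 2 volume := hφ.continuous.memLp_of_hasCompactSupport hφc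
    have hφ2 : ContDiff ℝ 2 φ := contDiff_infty.1 hφ 2
    have hd := hasDerivWithinAt_integral_mul (μ := volume) htI (V := fun _ => φ)
      (ψ := fun s => gaussian hbar (β s) (Z s) (G s)) (d := 0) (fun _ _ => hφL)
      (by simp only [sub_self, eLpNorm_zero]; exact tendsto_const_nhds)
      (fun s hs => h.memLp (hsub hs)) ((memLp_exp_neg_mul_norm_sq ha).const_mul C)
      (fun s hs z => h.abs_sub_le hbT (fun r hr => (hdom r hr z).2.2) hs htI)
      (fun z => (h.hasDerivWithinAt ht z).mono hsub) (hasDerivWithinAt_const _ _ _)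
    have hd2 := (hd.mono_of_mem_nhdsWithin (Icc_mem_nhdsWithin_Ico (T := T) htb)).const_mul hbar
    simp only [mul_comm (φ _)] at hd2
    refine hd2.congr_deriv ?_
    rw [zero_add, ← integral_wignerOp_mul hbar (h.symmH t ht.1) (contDiff_gaussian _ _ _ _) hφ2 hφc,
      ← integral_const_mul]
    refine integral_congr_ae (ae_of_all _ fun z => ?_)
    have := h.hbar_pos.ne'
    field_simp

end MovingGaussian

/-! ### Totality of translated Gaussians -/

/-- Uniqueness of the two-sided Laplace transform of a signed density: the positive and negative
parts define finite measures with the same moment generating functions, hence with the same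
characteristic function. -/
theorem ae_eq_zero_of_integral_mul_exp {E : Type*} [NormedAddCommGroup E] [NormedSpace ℝ E]
    [CompleteSpace E] [SecondCountableTopology E] [MeasurableSpace E] [BorelSpace E]
    {μ : Measure E} {u : E → ℝ}
    (hu : ∀ L : StrongDual ℝ E, Integrable (fun z => u z * Real.exp (L z)) μ)
    (h0 : ∀ L : StrongDual ℝ E, ∫ z, u z * Real.exp (L z) ∂μ = 0) : u =ᵐ[μ] 0 := by
  have hu0 : Integrable u μ := by simpa using hu 0
  have hum : AEMeasurable u μ := hu0.aestronglyMeasurable.aemeasurable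
  set p : E → ENNReal := fun z => ENNReal.ofReal (u z) with hp
  set m : E → ENNReal := fun z => ENNReal.ofReal (-u z) with hm
  have hpm : AEMeasurable p μ := hum.ennreal_ofReal
  have hmm : AEMeasurable m μ := hum.neg.ennreal_ofReal
  have hplt : ∀ᵐ z ∂μ, p z < ⊤ := ae_of_all _ fun _ => ENNReal.ofReal_lt_top
  have hmlt : ∀ᵐ z ∂μ, m z < ⊤ := ae_of_all _ fun _ => ENNReal.ofReal_lt_top
  have : IsFiniteMeasure (μ.withDensity p) := isFiniteMeasure_withDensity_ofReal hu0.2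
  have : IsFiniteMeasure (μ.withDensity m) := isFiniteMeasure_withDensity_ofReal hu0.neg.2
  have hpt : ∀ z, (p z).toReal = max (u z) 0 := fun z => ENNReal.toReal_ofReal'
  have hmt : ∀ z, (m z).toReal = max (-u z) 0 := fun z => ENNReal.toReal_ofReal'
  have hip : ∀ L : StrongDual ℝ E, Integrable (fun z => (p z).toReal • Real.exp (L z)) μ :=
    fun L => by
      refine (hu L).mono ((hpm.ennreal_toReal.mul
        (Real.measurable_exp.comp L.continuous.measurable).aemeasurable).aestronglyMeasurable)
        (ae_of_all _ fun z => ?_)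
      rw [hpt, smul_eq_mul, norm_mul, norm_mul]
      gcongr
      rw [Real.norm_eq_abs, Real.norm_eq_abs, abs_of_nonneg (le_max_right _ _)]
      exact max_le (le_abs_self _) (abs_nonneg _)
  have him : ∀ L : StrongDual ℝ E, Integrable (fun z => (m z).toReal • Real.exp (L z)) μ :=
    fun L => by
      refine (hu L).mono ((hmm.ennreal_toReal.mul
        (Real.measurable_exp.comp L.continuous.measurable).aemeasurable).aestronglyMeasurable)
        (ae_of_all _ fun z => ?_)
      rw [hmt, smul_eq_mul, norm_mul, norm_mul]
      gcongr
      rw [Real.norm_eq_abs, Real.norm_eq_abs, abs_of_nonneg (le_max_right _ _)]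
      exact max_le (neg_le_abs _) (abs_nonneg _)
  have hexp : ∀ L : StrongDual ℝ E, ∫ z, Real.exp (L z) ∂(μ.withDensity p)
      = ∫ z, Real.exp (L z) ∂(μ.withDensity m) := fun L => by
    rw [integral_withDensity_eq_integral_toReal_smul₀ hpm hplt,
      integral_withDensity_eq_integral_toReal_smul₀ hmm hmlt, ← sub_eq_zero,
      ← integral_sub (hip L) (him L), ← h0 L]
    refine integral_congr_ae (ae_of_all _ fun z => ?_)
    simp only [hpt, hmt, smul_eq_mul, ← sub_mul]
    congr 1
    rcases le_total (u z) 0 with h | h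
    · rw [max_eq_right h, max_eq_left (by linarith)]; ring
    · rw [max_eq_left h, max_eq_right (by linarith)]; ring
  have hmass : μ.withDensity p = 0 ↔ μ.withDensity m = 0 := by
    have h := hexp 0
    simp only [zero_apply, Real.exp_zero, integral_const, smul_eq_mul, mul_one] at h
    rw [← Measure.measure_univ_eq_zero, ← Measure.measure_univ_eq_zero,
      ← measureReal_eq_zero_iff, ← measureReal_eq_zero_iff, h]
  have hmeas : μ.withDensity p = μ.withDensity m := by
    refine Measure.ext_of_charFunDual (funext fun L => ?_)
    have hmgf : ProbabilityTheory.mgf L (μ.withDensity p)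
        = ProbabilityTheory.mgf L (μ.withDensity m) := funext fun t => by
      have := hexp (t • L)
      simpa [ProbabilityTheory.mgf] using this
    have hset : ProbabilityTheory.integrableExpSet L (μ.withDensity p) = univ := by
      refine eq_univ_of_forall fun t => ?_
      have h := (integrable_withDensity_iff_integrable_smul₀' hpm hplt).2 (hip (t • L))
      simpa [ProbabilityTheory.integrableExpSet] using h
    have h := ProbabilityTheory.eqOn_complexMGF_of_mgf' hmgf hmass
      (x := Complex.I) (by simp [hset])
    simp only [ProbabilityTheory.complexMGF] at h
    simpa only [charFunDual_apply, mul_comm Complex.I] using h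
  have hfin : ∫⁻ z, p z ∂μ ≠ ⊤ := by
    have := measure_lt_top (μ.withDensity p) univ
    rw [withDensity_apply _ MeasurableSet.univ, setLIntegral_univ] at this
    exact this.ne
  have hae := (withDensity_eq_iff hpm hmm hfin).1 hmeas
  filter_upwards [hae] with z hz
  have h1 : max (u z) 0 = max (-u z) 0 := by rw [← hpt, ← hmt, hz]
  rcases le_total (u z) 0 with h | h
  · rw [max_eq_right h, max_eq_left (by linarith)] at h1
    simpa using h1.symm
  · rw [max_eq_left h, max_eq_right (by linarith)] at h1
    simpa using h1

theorem dual_apply_eq_dotProduct {n : ℕ} (L : StrongDual ℝ (PhaseSpace n)) (z : PhaseSpace n) :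
    L z = z ⬝ᵥ fun i => L (Pi.single i 1) := by
  conv_lhs => rw [pi_eq_sum_univ' z]
  simp only [map_sum, map_smul, smul_eq_mul, dotProduct]

/-- The translates of the standard Gaussian are total in `L²`: pairing with them gives, up to
nonzero factors, the two-sided Laplace transform of `f e^{-|z|²/ħ}`. -/
theorem ae_eq_zero_of_integral_mul_gaussian {n : ℕ} {hbar : ℝ} (hbar0 : 0 < hbar)
    {f : PhaseSpace n → ℝ} (hf : MemLp f 2 volume)
    (h : ∀ Z₀ : PhaseSpace n, ∫ z, f z * gaussian hbar 0 Z₀ 1 z = 0)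
    (hL : ∀ Z₀ : PhaseSpace n, MemLp (gaussian hbar 0 Z₀ (1 : PhaseMat n)) 2 volume) :
    f =ᵐ[volume] 0 := by
  have hpi := Real.pi_pos
  have hid : ∀ (L : StrongDual ℝ (PhaseSpace n)), ∃ k : ℝ, ∃ Z₀ : PhaseSpace n, ∀ z,
      f z * Real.exp (-(1 / hbar) * (z ⬝ᵥ z)) * Real.exp (L z)
        = k * (f z * gaussian hbar 0 Z₀ 1 z) := fun L => by
    set w : PhaseSpace n := fun i => L (Pi.single i 1) with hw
    refine ⟨(Real.pi * hbar) ^ n * Real.exp (hbar / 4 * (w ⬝ᵥ w)), (hbar / 2) • w, fun z => ?_⟩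
    have e : Real.exp (-(1 / hbar) * (z ⬝ᵥ z)) * Real.exp (L z) =
        Real.exp (hbar / 4 * (w ⬝ᵥ w)) * Real.exp (-(1 / hbar) *
          ((z - (hbar / 2) • w) ⬝ᵥ ((1 : PhaseMat n) *ᵥ (z - (hbar / 2) • w)))) := by
      rw [← Real.exp_add, ← Real.exp_add, dual_apply_eq_dotProduct L z, ← hw]
      congr 1
      simp only [Matrix.one_mulVec, sub_dotProduct, dotProduct_sub, smul_dotProduct,
        dotProduct_smul, smul_eq_mul, dotProduct_comm w z]
      field_simp
      ring
    have hne : (Real.pi * hbar) ^ n ≠ 0 := by positivity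
    rw [mul_assoc, e, gaussian, neg_zero, Real.exp_zero]
    field_simp
  have key := ae_eq_zero_of_integral_mul_exp (μ := volume)
    (u := fun z => f z * Real.exp (-(1 / hbar) * (z ⬝ᵥ z))) (fun L => ?_) (fun L => ?_)
  · filter_upwards [key] with z hz
    simpa using hz
  · obtain ⟨k, Z₀, hk⟩ := hid L
    simp only [hk]
    exact (integrable_mul_of_memLp hf (hL Z₀)).const_mul k
  · obtain ⟨k, Z₀, hk⟩ := hid L
    simp only [hk]
    rw [integral_const_mul, h Z₀, mul_zero]

/-! ### Cutoff functions -/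

theorem grad_comp_smul {n : ℕ} (r : ℝ) (f : PhaseSpace n → ℝ) (z : PhaseSpace n) :
    grad (fun y => f (r • y)) z = r • grad f (r • z) := by
  funext i
  simp [grad, fderiv_comp_smul]

/-- The second partial derivative `∂ᵢ ∂ⱼ f`. -/
def hess {n : ℕ} (f : PhaseSpace n → ℝ) (i j : Idx n) (z : PhaseSpace n) : ℝ :=
  fderiv ℝ (fun y => grad f y j) z (Pi.single i 1)

theorem lapl_eq_sum_hess {n : ℕ} (K : PhaseMat n) {f : PhaseSpace n → ℝ} (hf : ContDiff ℝ 2 f)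
    (z : PhaseSpace n) :
    lapl K f z = -∑ i, ∑ j, ((Om n)ᵀ * K * Om n) i j * hess f i j z := by
  have hd := differentiable_pi.1 (differentiable_grad hf)
  simp only [lapl, diverg, Matrix.mulVec, dotProduct, hess]
  congr 1
  refine Finset.sum_congr rfl fun i _ => ?_
  rw [fderiv_fun_sum fun j _ => (hd j z).const_mul _, sum_apply]
  refine Finset.sum_congr rfl fun j _ => ?_
  rw [fderiv_const_mul (hd j z)]
  rfl

theorem hess_comp_smul {n : ℕ} (r : ℝ) {f : PhaseSpace n → ℝ} (hf : ContDiff ℝ 2 f) (i j : Idx n)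
    (z : PhaseSpace n) : hess (fun y => f (r • y)) i j z = r ^ 2 * hess f i j (r • z) := by
  have hd := differentiable_pi.1 (differentiable_grad hf) j
  have e : (fun y => grad (fun y => f (r • y)) y j) =
      fun y => r * (fun w => grad f w j) (r • y) := by
    funext y
    simp [grad_comp_smul]
  have hd' : DifferentiableAt ℝ (fun y => (fun w => grad f w j) (r • y)) z :=
    (hd (r • z)).comp z (differentiableAt_id.fun_const_smul r)
  rw [hess, e, fderiv_const_mul hd',
    fderiv_comp_smul (f := fun w => grad f w j) r, hess]
  simp only [smul_apply, smul_eq_mul]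
  ring

/-- Cutoff functions at scale `r⁻¹`, with first derivatives of order `r` and second derivatives of
order `r²`. -/
theorem exists_cutoff (n : ℕ) : ∃ χ : ℝ → PhaseSpace n → ℝ, ∃ M : ℝ, 0 ≤ M ∧
    (∀ r, 0 < r → HasCompactSupport (χ r)) ∧ ∀ r, ContDiff ℝ ∞ (χ r) ∧
      (∀ z, |χ r z| ≤ 1) ∧ (∀ z, r * ‖z‖ ≤ 1 → 0 ≤ r → χ r z = 1) ∧
      (∀ z, ‖grad (χ r) z‖ ≤ |r| * M) ∧ ∀ i j z, |hess (χ r) i j z| ≤ r ^ 2 * M := by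
  let f : ContDiffBump (0 : PhaseSpace n) := ⟨1, 2, one_pos, one_lt_two⟩
  have hfs : ContDiff ℝ ∞ f := f.contDiff
  have hf2 : ContDiff ℝ 2 f := contDiff_infty.1 hfs 2
  have h0 : ∀ z ∉ tsupport f, f z = 0 := fun z hz => image_eq_zero_of_notMem_tsupport hz
  have hc := f.hasCompactSupport
  have hg : HasCompactSupport (grad f) :=
    HasCompactSupport.intro hc (grad_eq_zero_of_vanish (isClosed_tsupport f) h0)
  obtain ⟨M1, hM1⟩ := hg.exists_bound_of_continuous
    (contDiff_grad (k := 0) hf2 (by norm_num)).continuous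
  have hh : ∀ i j, ∃ M, ∀ z, ‖hess f i j z‖ ≤ M := fun i j => by
    have hgj : ContDiff ℝ 1 fun y => grad f y j :=
      contDiff_pi.1 (contDiff_grad (k := 1) hf2 (by norm_num)) j
    have hcj : HasCompactSupport fun y => grad f y j :=
      hg.comp_left (g := fun v : PhaseSpace n => v j) rfl
    exact (hcj.fderiv_apply (𝕜 := ℝ) _).exists_bound_of_continuous
      ((hgj.continuous_fderiv one_ne_zero).clm_apply continuous_const)
  choose M2 hM2 using hh
  refine ⟨fun r z => f (r • z), |M1| + ∑ i, ∑ j, |M2 i j|, by positivity, fun r hr => ?_,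
    fun r => ⟨hfs.comp (contDiff_const_smul r), fun z => ?_, fun z hz hr => ?_,
      fun z => ?_, fun i j z => ?_⟩⟩
  · exact hc.comp_smul hr.ne'
  · rw [abs_of_nonneg f.nonneg]
    exact f.le_one
  · refine f.one_of_mem_closedBall ?_
    rw [mem_closedBall_zero_iff, norm_smul, Real.norm_eq_abs, abs_of_nonneg hr]
    exact hz
  · rw [grad_comp_smul, norm_smul, Real.norm_eq_abs]
    gcongr
    refine (hM1 _).trans ((le_abs_self _).trans (le_add_of_nonneg_right (by positivity)))
  · rw [hess_comp_smul r hf2, abs_mul, abs_of_nonneg (sq_nonneg r)]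
    gcongr
    refine (hM2 i j _).trans ((le_abs_self _).trans ?_)
    have h1 : |M2 i j| ≤ ∑ j, |M2 i j| :=
      Finset.single_le_sum (f := fun j => |M2 i j|) (fun _ _ => abs_nonneg _) (Finset.mem_univ j)
    have h2 : ∑ j, |M2 i j| ≤ ∑ i, ∑ j, |M2 i j| :=
      Finset.single_le_sum (f := fun i => ∑ j, |M2 i j|)
        (fun _ _ => Finset.sum_nonneg fun _ _ => abs_nonneg _) (Finset.mem_univ i)
    exact h1.trans (h2.trans (le_add_of_nonneg_left (abs_nonneg _)))

/-- A cutoff at scale `r⁻¹` acts on a dominated function at the cost of an error of order `r`. The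
transport term has a coefficient growing linearly in `z`, which the weight on `f` absorbs. -/
theorem abs_cutoffError_le {n : ℕ} {hbar B M r C : ℝ} (hbar0 : 0 < hbar) (hr : 0 < r)
    (hr1 : r ≤ 1)
    {H : Matrix (Idx n) (Idx n) ℂ} (hB : 0 ≤ B) (hM : 0 ≤ M)
    (hS : ∀ i j, |((Om n)ᵀ * imMat H * Om n) i j| ≤ B)
    (hA : ∀ i j, |(reMat H * Om n)ᵀ i j| ≤ B) {χ f : PhaseSpace n → ℝ} (hχ : ContDiff ℝ 2 χ)
    {z : PhaseSpace n} (hχg : ‖grad χ z‖ ≤ r * M) (hχh : ∀ i j, |hess χ i j z| ≤ r ^ 2 * M)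
    (hf : (1 + ‖z‖) ^ 2 * f z ≤ C) (hf0 : 0 ≤ f z) (hfg : ‖grad f z‖ ≤ C) :
    |cutoffError hbar H χ f z| ≤
      (3 * hbar ^ 2 / 4 + hbar) * ((Fintype.card (Idx n) : ℝ) ^ 2 * B * M) * r * C := by
  set N : ℝ := (Fintype.card (Idx n) : ℝ) ^ 2 with hN
  have hN0 : 0 ≤ N := by positivity
  have hz := norm_nonneg z
  have hf1 : f z ≤ C := le_trans (le_mul_of_one_le_left hf0 (one_le_pow₀ (by linarith))) hf
  have hf2 : f z * ‖z‖ ≤ C := by nlinarith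
  have hC : 0 ≤ C := hf0.trans hf1
  have h1 : |lapl (imMat H) χ z| ≤ N * B * M * r := by
    rw [lapl_eq_sum_hess _ hχ, abs_neg]
    calc _ ≤ ∑ i, ∑ j, |((Om n)ᵀ * imMat H * Om n) i j * hess χ i j z| :=
          (Finset.abs_sum_le_sum_abs _ _).trans
            (Finset.sum_le_sum fun i _ => Finset.abs_sum_le_sum_abs _ _)
      _ ≤ ∑ _i : Idx n, ∑ _j : Idx n, B * (r * M) := by
          refine Finset.sum_le_sum fun i _ => Finset.sum_le_sum fun j _ => ?_
          rw [abs_mul]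
          have h3 : r ^ 2 * M ≤ r * M := by
            gcongr
            nlinarith
          have := (hχh i j).trans h3
          have := hS i j
          gcongr
      _ = N * B * M * r := by
          simp only [Finset.sum_const, Finset.card_univ, nsmul_eq_mul, hN]
          ring
  have h2 : |grad χ z ⬝ᵥ (((Om n)ᵀ * imMat H * Om n) *ᵥ grad f z)| ≤ N * B * M * r * C :=
    calc _ ≤ N * B * (‖grad χ z‖ * ‖grad f z‖) := abs_dotProduct_mulVec_le hS _ _
      _ ≤ N * B * ((r * M) * C) := by gcongr
      _ = _ := by ring
  have h3 : |grad χ z ⬝ᵥ (z ᵥ* (reMat H * Om n))| ≤ N * B * M * r * ‖z‖ := by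
    rw [← Matrix.mulVec_transpose]
    calc _ ≤ N * B * (‖grad χ z‖ * ‖z‖) := abs_dotProduct_mulVec_le hA _ _
      _ ≤ N * B * ((r * M) * ‖z‖) := by gcongr
      _ = _ := by ring
  have h4 : |f z * lapl (imMat H) χ z| ≤ N * B * M * r * C := by
    rw [abs_mul, abs_of_nonneg hf0, mul_comm]
    gcongr
  have h5 : |f z * (grad χ z ⬝ᵥ (z ᵥ* (reMat H * Om n)))| ≤ N * B * M * r * C := by
    rw [abs_mul, abs_of_nonneg hf0]
    calc _ ≤ f z * (N * B * M * r * ‖z‖) := by gcongr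
      _ = N * B * M * r * (f z * ‖z‖) := by ring
      _ ≤ _ := by gcongr
  have h6 : |f z * lapl (imMat H) χ z
      - 2 * (grad χ z ⬝ᵥ (((Om n)ᵀ * imMat H * Om n) *ᵥ grad f z))| ≤ 3 * (N * B * M * r * C) := by
    rw [abs_le] at h4 h2 ⊢
    constructor <;> linarith [h4.1, h4.2, h2.1, h2.2]
  rw [cutoffError]
  calc _ ≤ _ := abs_sub _ _
    _ ≤ hbar ^ 2 / 4 * (3 * (N * B * M * r * C)) + hbar * (N * B * M * r * C) := by
        rw [abs_mul, abs_mul, abs_of_pos hbar0, abs_of_pos (show 0 < hbar ^ 2 / 4 by positivity)]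
        gcongr
    _ = _ := by ring

variable {n : ℕ} {hbar c T : ℝ} {H : ℝ → Matrix (Idx n) (Idx n) ℂ} {G : ℝ → PhaseMat n}
  {Z : ℝ → PhaseSpace n} {β : ℝ → ℝ} {V W : ℝ → PhaseSpace n → ℝ}

/-! ### Uniqueness by duality -/

theorem IsL2Solution.sub (hV : IsL2Solution hbar H T V) (hW : IsL2Solution hbar H T W) :
    IsL2Solution hbar H T fun t z => V t z - W t z := by
  refine ⟨fun t ht => (hV.memLp t ht).sub (hW.memLp t ht), fun t ht => ?_,
    fun φ hφ hφc t ht => ?_⟩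
  · have h := (hV.continuous t ht).add (hW.continuous t ht)
    rw [add_zero] at h
    refine tendsto_of_tendsto_of_tendsto_of_le_of_le' tendsto_const_nhds h
      (Eventually.of_forall fun _ => zero_le) ?_
    filter_upwards [self_mem_nhdsWithin] with s hs
    have e : ((fun z => V s z - W s z) - fun z => V t z - W t z)
        = (V s - V t) - (W s - W t) := by
      funext z
      simp only [Pi.sub_apply]
      ring
    rw [e]
    exact eLpNorm_sub_le ((hV.memLp s hs).sub (hV.memLp t ht)).1
      ((hW.memLp s hs).sub (hW.memLp t ht)).1 one_le_two
  · have hφL : MemLp φ 2 volume := hφ.continuous.memLp_of_hasCompactSupport hφc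
    have hφ2 : ContDiff ℝ 2 φ := contDiff_infty.1 hφ 2
    have hwL : MemLp (wignerOpTranspose hbar (H t) φ) 2 volume :=
      (continuous_wignerOpTranspose hbar (H t) hφ2).memLp_of_hasCompactSupport
        (hasCompactSupport_wignerOpTranspose hbar (H t) hφc)
    have h := (hV.weak φ hφ hφc t ht).sub (hW.weak φ hφ hφc t ht)
    have e : ∀ s ∈ Ico 0 T, hbar * ∫ z, (V s z - W s z) * φ z
        = hbar * (∫ z, V s z * φ z) - hbar * ∫ z, W s z * φ z := fun s hs => by
      simp only [sub_mul]
      rw [integral_sub (integrable_mul_of_memLp (hV.memLp s hs) hφL)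
        (integrable_mul_of_memLp (hW.memLp s hs) hφL), mul_sub]
    refine (h.congr_of_mem e ht).congr_deriv ?_
    simp only [sub_mul]
    rw [integral_sub (integrable_mul_of_memLp (hV.memLp t ht) hwL)
      (integrable_mul_of_memLp (hW.memLp t ht) hwL)]

theorem IsL2Solution.exists_bound (hV : IsL2Solution hbar H T V) {g : PhaseSpace n → ℝ}
    (hg : MemLp g 2 volume) {b : ℝ} (hb : b < T) :
    ∃ M, ∀ s ∈ Icc 0 b, ∫ z, |V s z| * g z ≤ M := by
  have hsub : Icc 0 b ⊆ Ico 0 T := fun s hs => ⟨hs.1, hs.2.trans_lt hb⟩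
  have hcont : ContinuousOn (fun s => ∫ z, |V s z| * g z) (Icc 0 b) := by
    intro t ht
    have hVt := hV.memLp t (hsub ht)
    rw [ContinuousWithinAt, ← tendsto_sub_nhds_zero_iff, tendsto_zero_iff_enorm_tendsto_zero]
    have h3 : Tendsto (fun s => eLpNorm (V s - V t) 2 volume * eLpNorm g 2 volume) (𝓝[Icc 0 b] t)
        (𝓝 0) := by
      have := ENNReal.Tendsto.mul_const (b := eLpNorm g 2 volume)
        ((hV.continuous t (hsub ht)).mono_left (nhdsWithin_mono t hsub)) (Or.inr hg.2.ne)
      simpa using this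
    refine tendsto_of_tendsto_of_tendsto_of_le_of_le' tendsto_const_nhds h3
      (Eventually.of_forall fun _ => zero_le) ?_
    filter_upwards [self_mem_nhdsWithin] with s hs
    have hVs := hV.memLp s (hsub hs)
    have iS : Integrable fun z => |V s z| * g z := integrable_mul_of_memLp hVs.abs hg
    have iT : Integrable fun z => |V t z| * g z := integrable_mul_of_memLp hVt.abs hg
    rw [← integral_sub iS iT]
    simp only [← sub_mul]
    refine (enorm_integral_mul_le (f := fun z => |V s z| - |V t z|) (hVs.abs.sub hVt.abs)
      hg).trans ?_
    gcongr
    exact eLpNorm_mono fun z => abs_abs_sub_abs_le_abs_sub _ _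
  obtain ⟨M, hM⟩ := isCompact_Icc.exists_bound_of_continuousOn hcont
  exact ⟨M, fun s hs => (le_abs_self _).trans (hM s hs)⟩

/-- A solution with vanishing initial value is orthogonal at time `t₁` to the initial value of any
moving Gaussian for the Hamiltonian with reversed time and reversed real part: run backwards from
`t₁`, that Gaussian solves the adjoint equation, so its pairing with the solution is conserved.
Cutoffs at scale `r⁻¹` make it an admissible test function, at the price of an error of
order `r`. -/
theorem IsL2Solution.integral_mul_gaussian_eq_zero (hV : IsL2Solution hbar H T V)
    (hHc : ContinuousOn H (Ici 0)) (hHs : ∀ t, 0 ≤ t → (H t).IsSymm)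
    (hV0 : V 0 =ᵐ[volume] 0) {t₁ : ℝ} (ht₁ : t₁ ∈ Ico 0 T)
    {H' : ℝ → Matrix (Idx n) (Idx n) ℂ} {T' : ℝ} (hT' : t₁ < T')
    (hre : ∀ s ∈ Icc 0 t₁, reMat (H' (t₁ - s)) = -reMat (H s))
    (him : ∀ s ∈ Icc 0 t₁, imMat (H' (t₁ - s)) = imMat (H s))
    (h : IsGaussianPath hbar c H' T' G Z β) :
    ∫ z, V t₁ z * gaussian hbar (β 0) (Z 0) (G 0) z = 0 := by
  have hh := h.hbar_pos
  obtain ⟨a, ha, C, hC, hdom⟩ := h.exists_dominated hT'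
  set γ : ℝ → PhaseSpace n → ℝ := fun τ => gaussian hbar (β τ) (Z τ) (G τ) with hγ
  set g : PhaseSpace n → ℝ := fun z => C * Real.exp (-a * ‖z‖ ^ 2) with hg
  have hg0 : ∀ z, 0 < g z := fun z => by positivity
  have hgL : MemLp g 2 volume := (memLp_exp_neg_mul_norm_sq ha).const_mul C
  have hγc : ∀ τ {k : WithTop ℕ∞}, ContDiff ℝ k (γ τ) := fun τ => contDiff_gaussian _ _ _ _
  have hsub : Icc 0 t₁ ⊆ Ico 0 T := fun s hs => ⟨hs.1, hs.2.trans_lt ht₁.2⟩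
  have hsub' : Icc 0 t₁ ⊆ Ico 0 T' := fun s hs => ⟨hs.1, hs.2.trans_lt hT'⟩
  have hrefl : ∀ s ∈ Icc 0 t₁, t₁ - s ∈ Icc 0 t₁ := fun s hs =>
    ⟨by linarith [hs.2], by linarith [hs.1]⟩
  obtain ⟨Mv, hMv⟩ := hV.exists_bound hgL ht₁.2
  obtain ⟨χ, M, hM, hχc, hχ⟩ := exists_cutoff n
  have cH : ContinuousOn H (Icc 0 t₁) := hHc.mono Icc_subset_Ici_self
  obtain ⟨B1, hB1⟩ := exists_entry_bound (M := fun t => (Om n)ᵀ * imMat (H t) * Om n)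
    isCompact_Icc (((continuous_const.matrix_mul continuous_imMat).matrix_mul
      continuous_const).comp_continuousOn cH)
  obtain ⟨B2, hB2⟩ := exists_entry_bound (M := fun t => (reMat (H t) * Om n)ᵀ)
    isCompact_Icc ((continuous_reMat.matrix_mul
      continuous_const).matrix_transpose.comp_continuousOn cH)
  set B := max (max B1 B2) 0 with hB
  have hB0 : 0 ≤ B := le_max_right _ _
  -- `D r` bounds the commutator of the adjoint equation with the cutoff at scale `r⁻¹`
  set D : ℝ := (3 * hbar ^ 2 / 4 + hbar) * ((Fintype.card (Idx n) : ℝ) ^ 2 * B * M) with hD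
  have hD0 : 0 ≤ D := by positivity
  have herr : ∀ r, 0 < r → r ≤ 1 → ∀ s ∈ Icc 0 t₁, ∀ z,
      |cutoffError hbar (H s) (χ r) (γ (t₁ - s)) z| ≤ D * r * g z := fun r hr hr1 s hs z => by
    obtain ⟨d1, d2, -⟩ := hdom _ (hrefl s hs) z
    exact abs_cutoffError_le hh hr hr1 hB0 hM
      (fun i j => (hB1 s hs i j).trans ((le_max_left _ _).trans (le_max_left _ _)))
      (fun i j => (hB2 s hs i j).trans ((le_max_right _ _).trans (le_max_left _ _)))
      (contDiff_infty.1 (hχ r).1 2) (by simpa [abs_of_pos hr] using (hχ r).2.2.2.1 z)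
      (fun i j => (hχ r).2.2.2.2 i j z) d1 (gaussian_pos hh _ _ _ z).le d2
  set F : ℝ → ℝ → ℝ := fun r s => ∫ z, V s z * (χ r z * γ (t₁ - s) z) with hF
  have hψc : ∀ r, 0 < r → ∀ s, HasCompactSupport fun z => χ r z * γ (t₁ - s) z :=
    fun r hr s => (hχc r hr).mul_right
  have hψs : ∀ r s, ContDiff ℝ ∞ fun z => χ r z * γ (t₁ - s) z :=
    fun r s => (hχ r).1.mul (hγc _)
  have hFd : ∀ r, 0 < r → ∀ s ∈ Icc 0 t₁, HasDerivWithinAt (F r)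
      (1 / hbar * ∫ z, V s z * cutoffError hbar (H s) (χ r) (γ (t₁ - s)) z) (Icc 0 t₁) s := by
    intro r hr s hs
    have hVs := hV.memLp s (hsub hs)
    have hγd : ∀ z, HasDerivWithinAt (fun s => γ (t₁ - s) z)
        (-(1 / hbar * wignerOpTranspose hbar (H s) (γ (t₁ - s)) z)) (Icc 0 t₁) s := fun z => by
      rw [wignerOpTranspose_eq hbar (hHs s hs.1) (hre s hs) (him s hs) (hγc _)]
      have h1 : HasDerivWithinAt (fun s => t₁ - s) (-1) (Icc 0 t₁) s :=
        ((hasDerivAt_id s).const_sub t₁).hasDerivWithinAt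
      have h2 := (h.hasDerivWithinAt (hsub' (hrefl s hs)) z).scomp s h1
        (fun r hr => hsub' (hrefl r hr))
      exact h2.congr_deriv (by simp [hγ])
    have hd := hasDerivWithinAt_integral_mul (μ := volume) hs (V := V)
      (ψ := fun s z => χ r z * γ (t₁ - s) z) (fun s hs => hV.memLp s (hsub hs))
      ((hV.continuous s (hsub hs)).mono_left (nhdsWithin_mono s hsub))
      (fun s _ => (hψs r s).continuous.memLp_of_hasCompactSupport (hψc r hr s)) hgL
      (fun s' hs' z => ?_) (fun z => (hγd z).const_mul (χ r z))
      (((hV.weak _ (hψs r s) (hψc r hr s) s (hsub hs)).mono hsub).const_mul (1 / hbar)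
        |>.congr_of_mem (fun s _ => by field_simp) hs)
    · refine hd.congr_deriv ?_
      have i1 : Integrable fun z => V s z *
          wignerOpTranspose hbar (H s) (fun z => χ r z * γ (t₁ - s) z) z :=
        integrable_mul_of_memLp hVs ((continuous_wignerOpTranspose hbar (H s)
          (contDiff_infty.1 (hψs r s) 2)).memLp_of_hasCompactSupport
          (hasCompactSupport_wignerOpTranspose hbar (H s) (hψc r hr s)))
      have i2 : Integrable fun z => V s z * (χ r z *
          -(1 / hbar * wignerOpTranspose hbar (H s) (γ (t₁ - s)) z)) :=
        integrable_mul_of_memLp hVs (((hχ r).1.continuous.mul (continuous_const.mul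
          (continuous_wignerOpTranspose hbar (H s) (hγc _))).neg).memLp_of_hasCompactSupport
          (hχc r hr).mul_right)
      rw [← integral_const_mul, ← integral_const_mul, ← integral_add (i1.const_mul _) i2]
      refine integral_congr_ae (ae_of_all _ fun z => ?_)
      simp only [wignerOpTranspose_mul hbar (hHs s hs.1) (contDiff_infty.1 (hχ r).1 2) (hγc _)]
      ring
    · rw [← mul_sub, abs_mul]
      have h1 := h.abs_sub_le hT' (z := z) (fun r hr => (hdom r hr z).2.2) (hrefl s' hs')
        (hrefl s hs)
      rw [show t₁ - s' - (t₁ - s) = -(s' - s) by ring, abs_neg] at h1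
      calc _ ≤ 1 * _ := mul_le_mul_of_nonneg_right ((hχ r).2.1 z) (abs_nonneg _)
        _ ≤ _ := by rw [one_mul]; exact h1
  have hFle : ∀ r, 0 < r → r ≤ 1 → |F r t₁| ≤ 1 / hbar * (D * r * Mv) * t₁ := by
    intro r hr hr1
    have h0 : F r 0 = 0 := by
      rw [hF]
      refine integral_eq_zero_of_ae ?_
      filter_upwards [hV0] with z hz
      simp [hz]
    have hle := (convex_Icc 0 t₁).norm_image_sub_le_of_norm_hasDerivWithin_le
      (C := 1 / hbar * (D * r * Mv)) (hFd r hr) (fun s hs => ?_) ⟨le_rfl, ht₁.1⟩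
      (⟨ht₁.1, le_rfl⟩ : t₁ ∈ Icc 0 t₁)
    · rw [h0, sub_zero, sub_zero, Real.norm_eq_abs, Real.norm_eq_abs, abs_of_nonneg ht₁.1] at hle
      exact hle
    · have hVs := hV.memLp s (hsub hs)
      rw [norm_mul, Real.norm_eq_abs, abs_of_pos (show 0 < 1 / hbar by positivity)]
      gcongr
      calc _ ≤ ∫ z, D * r * (|V s z| * g z) := by
            refine norm_integral_le_of_norm_le
              ((integrable_mul_of_memLp hVs.abs hgL).const_mul _) (ae_of_all _ fun z => ?_)
            rw [norm_mul, Real.norm_eq_abs, Real.norm_eq_abs]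
            calc _ ≤ |V s z| * (D * r * g z) := by gcongr; exact herr r hr hr1 s hs z
              _ = _ := by ring
        _ ≤ D * r * Mv := by
            rw [integral_const_mul]
            gcongr
            exact hMv s hs
  have hlim0 : Tendsto (fun k : ℕ => F (1 / ((k : ℝ) + 1)) t₁) atTop (𝓝 0) := by
    have h1 : Tendsto (fun k : ℕ => 1 / hbar * (D * (1 / ((k : ℝ) + 1)) * Mv) * t₁) atTop
        (𝓝 (1 / hbar * (D * 0 * Mv) * t₁)) :=
      (((tendsto_one_div_add_atTop_nhds_zero_nat.const_mul D).mul_const Mv).const_mul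
        (1 / hbar)).mul_const t₁
    simp only [mul_zero, zero_mul] at h1
    refine squeeze_zero_norm (fun k => ?_) h1
    refine hFle (1 / ((k : ℝ) + 1)) (by positivity) ?_
    rw [div_le_one (by positivity)]
    linarith [(Nat.cast_nonneg k : (0 : ℝ) ≤ k)]
  have hlim1 : Tendsto (fun k : ℕ => F (1 / ((k : ℝ) + 1)) t₁) atTop
      (𝓝 (∫ z, V t₁ z * γ 0 z)) := by
    have hγL : MemLp (γ 0) 2 volume := h.memLp (hsub' ⟨le_rfl, ht₁.1⟩)
    have hVt := hV.memLp t₁ ht₁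
    have hint := integrable_mul_of_memLp hVt hγL
    simp only [hF, sub_self]
    refine tendsto_integral_of_dominated_convergence (fun z => ‖V t₁ z * γ 0 z‖) (fun k => ?_)
      hint.norm (fun k => ae_of_all _ fun z => ?_) (ae_of_all _ fun z => ?_)
    · exact hVt.1.mul ((hχ _).1.continuous.aestronglyMeasurable.mul hγL.1)
    · rw [norm_mul, norm_mul, norm_mul]
      gcongr
      exact mul_le_of_le_one_left (norm_nonneg _) ((hχ _).2.1 z)
    · refine tendsto_const_nhds.congr' ?_
      filter_upwards [eventually_ge_atTop ⌈‖z‖⌉₊] with k hk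
      have hk' : ‖z‖ ≤ k := Nat.ceil_le.1 hk
      rw [(hχ _).2.2.1 z ?_ (by positivity), one_mul]
      rw [one_div_mul_eq_div, div_le_one (by positivity)]
      linarith
  exact tendsto_nhds_unique hlim1 hlim0

/-! ### Existence of moving Gaussians -/

theorem IsDoubledFlow.isGaussianPath {Φ : ℝ → Matrix (Idx n ⊕ Idx n) (Idx n ⊕ Idx n) ℝ}
    (hΦ : IsDoubledFlow H T Φ) (hbar0 : 0 < hbar) (hc : 0 < c) (hHc : ContinuousOn H (Ici 0))
    (hHs : ∀ t, 0 ≤ t → (H t).IsSymm) {G₀ : PhaseMat n} (hG₀ : G₀ᵀ = G₀)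
    (hu : ∀ t ∈ Ico 0 T, IsUnit (actDenom (Φ t) G₀) ∧
      ∀ z : PhaseSpace n, c * ‖z‖ ^ 2 ≤ z ⬝ᵥ (act (Φ t) G₀ *ᵥ z)) {Z₀ : PhaseSpace n}
    (hZ : IsCentre H T (fun t => act (Φ t) G₀) Z₀ Z)
    (hβ : IsNormalisation hbar H T (fun t => act (Φ t) G₀) Z β) :
    IsGaussianPath hbar c H T (fun t => act (Φ t) G₀) Z β where
  hbar_pos := hbar0
  c_pos := hc
  contH := hHc
  symmH := hHs
  symm t ht := hΦ.act_transpose hHs hG₀ ht (hu t ht).1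
  lower _ ht := (hu _ ht).2
  derivG t ht i j := hΦ.hasDeriv_act (fun t ht => (hu t ht).1) ht i j
  derivZ := hZ.2
  derivβ := hβ.2

theorem IsDoubledFlow.continuousOn_act
    {Φ : ℝ → Matrix (Idx n ⊕ Idx n) (Idx n ⊕ Idx n) ℝ} (hΦ : IsDoubledFlow H T Φ)
    {G₀ : PhaseMat n} (hu : ∀ t ∈ Ico 0 T, IsUnit (actDenom (Φ t) G₀)) :
    ContinuousOn (fun t => act (Φ t) G₀) (Ico 0 T) := fun _ ht =>
  continuousWithinAt_matrix fun i j => (hΦ.hasDeriv_act hu ht i j).continuousWithinAt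

/-- Existence of a moving Gaussian with prescribed initial data, from a doubled flow that stays in
the domain of the fractional linear action. -/
theorem exists_isGaussianPath {n : ℕ} {hbar c T : ℝ} {H : ℝ → Matrix (Idx n) (Idx n) ℂ}
    (hbar0 : 0 < hbar) (hc : 0 < c)
    (hHc : ContinuousOn H (Ici 0)) (hHs : ∀ t, 0 ≤ t → (H t).IsSymm) {G₀ : PhaseMat n}
    (hG₀ : G₀.PosDef)
    (hflow : ∃ Φ, IsDoubledFlow H T Φ) (hlow : ∀ Φ, IsDoubledFlow H T Φ → ∀ t ∈ Ico 0 T,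
        IsUnit (actDenom (Φ t) G₀) ∧
          ∀ z : PhaseSpace n, c * ‖z‖ ^ 2 ≤ z ⬝ᵥ (act (Φ t) G₀ *ᵥ z)) (Z₀ : PhaseSpace n) :
    ∃ G Z β, IsGaussianPath hbar c H T G Z β ∧ G 0 = G₀ ∧ Z 0 = Z₀ ∧ β 0 = 0 := by
  obtain ⟨Φ, hΦ⟩ := hflow
  have hu := hlow Φ hΦ
  have hGt : G₀ᵀ = G₀ := hG₀.1
  have hpos : ∀ t ∈ Ico 0 T, (act (Φ t) G₀).PosDef := fun t ht =>
    posDef_of_lower_bound (hΦ.act_transpose hHs hGt ht (hu t ht).1) hc (hu t ht).2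
  obtain ⟨Z, hZ⟩ := hΦ.exists_centre hHs hG₀ (fun t ht => (hu t ht).1) hpos Z₀
  obtain ⟨β, hβ⟩ := exists_normalisation (hbar := hbar) hHc
    (hΦ.continuousOn_act fun t ht => (hu t ht).1)
    (fun t ht => (hZ.2 t ht).continuousWithinAt)
  exact ⟨_, Z, β, hΦ.isGaussianPath hbar0 hc hHc hHs hGt hu hZ hβ, by
    simp only [hΦ.1, act_one], hZ.1, hβ.1⟩

theorem exists_common_bound (hH : ContinuousOn H (Ici 0)) :
    ∃ B, ∀ t ∈ Icc (0 : ℝ) 1, ∀ i j, ‖H t i j‖ ≤ B := by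
  have hH' : ContinuousOn (fun s => (fun i j => H s i j : Idx n → Idx n → ℂ)) (Icc 0 1) :=
    hH.mono Icc_subset_Ici_self
  obtain ⟨B, hB⟩ := isCompact_Icc.exists_bound_of_continuousOn hH'
  exact ⟨B, fun s hs i j => (norm_le_pi_norm (fun j => H s i j) j).trans
    ((norm_le_pi_norm (fun i j => H s i j) i).trans (hB s hs))⟩

/-! ### The Hamiltonian of the adjoint problem -/

/-- The Hamiltonian of the adjoint problem run backwards from time `t₁`: `-conj (H (t₁ - τ))`, which
has real part `-Re H` and imaginary part `Im H`. Times are truncated at `0`, where `H` starts to be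
controlled. -/
def reversedHam (H : ℝ → Matrix (Idx n) (Idx n) ℂ) (t₁ : ℝ) (τ : ℝ) :
    Matrix (Idx n) (Idx n) ℂ :=
  -((H (max (t₁ - τ) 0)).map star)

theorem reMat_reversedHam {t₁ s : ℝ} (hs : 0 ≤ s) :
    reMat (reversedHam H t₁ (t₁ - s)) = -reMat (H s) := by
  ext i j
  simp [reMat, reversedHam, hs]

theorem imMat_reversedHam {t₁ s : ℝ} (hs : 0 ≤ s) :
    imMat (reversedHam H t₁ (t₁ - s)) = imMat (H s) := by
  ext i j
  simp [imMat, reversedHam, hs]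

theorem continuous_reversedHam (hH : ContinuousOn H (Ici 0)) (t₁ : ℝ) :
    Continuous (reversedHam H t₁) := by
  have h : Continuous fun τ => H (max (t₁ - τ) 0) :=
    hH.comp_continuous ((continuous_const.sub continuous_id).max continuous_const)
      fun τ => mem_Ici.2 (le_max_right _ _)
  exact (h.matrix_map continuous_star).neg

theorem isSymm_reversedHam (hH : ∀ t, 0 ≤ t → (H t).IsSymm) (t₁ τ : ℝ) :
    (reversedHam H t₁ τ).IsSymm :=
  ((hH _ (le_max_right _ _)).map _).neg

end WignerGaussian

end

open WignerGaussian in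
theorem theorem4 (n : ℕ) (H : ℝ → Matrix (WignerGaussian.Idx n) (WignerGaussian.Idx n) ℂ)
    (hHcont : ContinuousOn H (Set.Ici 0)) (hHsymm : ∀ t, 0 ≤ t → (H t).IsSymm)
    (G : WignerGaussian.PhaseMat n) (hGpos : G.PosDef)
    (hGsymp : G ∈ Matrix.symplecticGroup (Fin n) ℝ) :
    ∃ T : ℝ, 0 < T ∧
      (∃ Φ, WignerGaussian.IsDoubledFlow H T Φ) ∧
      ∀ Φ, WignerGaussian.IsDoubledFlow H T Φ →
        (∀ t ∈ Set.Ico 0 T, IsUnit (WignerGaussian.actDenom (Φ t) G) ∧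
          (WignerGaussian.act (Φ t) G).PosDef) ∧
        ∀ (hbar : ℝ), 0 < hbar → ∀ Z₀ : WignerGaussian.PhaseSpace n,
          (∃ Z, WignerGaussian.IsCentre H T (fun t => WignerGaussian.act (Φ t) G) Z₀ Z) ∧
          ∀ Z, WignerGaussian.IsCentre H T (fun t => WignerGaussian.act (Φ t) G) Z₀ Z →
            (∃ β, WignerGaussian.IsNormalisation hbar H T
              (fun t => WignerGaussian.act (Φ t) G) Z β) ∧
            ∀ β, WignerGaussian.IsNormalisation hbar H T
                (fun t => WignerGaussian.act (Φ t) G) Z β →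
              -- the Gaussian has the prescribed initial value and solves the equation,
              WignerGaussian.gaussian hbar (β 0) (Z 0) (WignerGaussian.act (Φ 0) G) =
                WignerGaussian.gaussian hbar 0 Z₀ G ∧
              WignerGaussian.IsClassicalSolution hbar H T
                (fun t => WignerGaussian.gaussian hbar (β t) (Z t)
                  (WignerGaussian.act (Φ t) G)) ∧
              WignerGaussian.IsL2Solution hbar H T
                (fun t => WignerGaussian.gaussian hbar (β t) (Z t)
                  (WignerGaussian.act (Φ t) G)) ∧
              -- and every solution with that initial value coincides with it.
              ∀ W : ℝ → WignerGaussian.PhaseSpace n → ℝ,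
                WignerGaussian.IsL2Solution hbar H T W →
                W 0 =ᵐ[MeasureTheory.volume] WignerGaussian.gaussian hbar 0 Z₀ G →
                ∀ t ∈ Set.Ico 0 T, W t =ᵐ[MeasureTheory.volume]
                  WignerGaussian.gaussian hbar (β t) (Z t) (WignerGaussian.act (Φ t) G) := by
  have hGt : Gᵀ = G := hGpos.1
  obtain ⟨B, hB⟩ := exists_common_bound hHcont
  obtain ⟨δ, hδ, c, hc, hflow⟩ := exists_flow_time hGpos B
  -- the second time bound is for the adjoint problem, started from standard Gaussians
  obtain ⟨δ', hδ', c', hc', hflow'⟩ := exists_flow_time (Matrix.PosDef.one (n := Idx n) (R := ℝ)) B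
  set T := min 1 (min δ δ') with hT
  have hT0 : 0 < T := by positivity
  have hT1 : T ≤ 1 := min_le_left _ _
  have hBT : ∀ t ∈ Icc 0 T, ∀ i j, ‖H t i j‖ ≤ B := fun t ht => hB t ⟨ht.1, ht.2.trans hT1⟩
  obtain ⟨hex, hlow⟩ := hflow H hHcont T ((min_le_right _ _).trans (min_le_left _ _)) hBT
  refine ⟨T, hT0, hex, fun Φ hΦ => ?_⟩
  have hu := hlow Φ hΦ
  have hpos : ∀ t ∈ Ico 0 T, (act (Φ t) G).PosDef := fun t ht =>
    posDef_of_lower_bound (hΦ.act_transpose hHsymm hGt ht (hu t ht).1) hc (hu t ht).2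
  refine ⟨fun t ht => ⟨(hu t ht).1, hpos t ht⟩, fun hbar hbar0 Z₀ =>
    ⟨hΦ.exists_centre hHsymm hGpos (fun t ht => (hu t ht).1) hpos Z₀, fun Z hZ =>
      ⟨exists_normalisation hHcont (hΦ.continuousOn_act fun t ht => (hu t ht).1)
        fun t ht => (hZ.2 t ht).continuousWithinAt, fun β hβ => ?_⟩⟩⟩
  have path := hΦ.isGaussianPath hbar0 hc hHcont hHsymm hGt hu hZ hβ
  have hinit : gaussian hbar (β 0) (Z 0) (act (Φ 0) G) = gaussian hbar 0 Z₀ G := by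
    rw [hβ.1, hZ.1, hΦ.1, act_one]
  refine ⟨hinit, path.isClassicalSolution, path.isL2Solution, fun W hW hW0 t₁ ht₁ => ?_⟩
  have hV := hW.sub path.isL2Solution
  have hV0 : (fun z => W 0 z - gaussian hbar (β 0) (Z 0) (act (Φ 0) G) z) =ᵐ[volume] 0 := by
    filter_upwards [hW0] with z hz
    rw [hz, hinit, sub_self, Pi.zero_apply]
  have hBr : ∀ τ ∈ Icc 0 T, ∀ i j, ‖reversedHam H t₁ τ i j‖ ≤ B := fun τ hτ i j => by
    have := hB (max (t₁ - τ) 0) ⟨le_max_right _ _,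
      max_le (by linarith [hτ.1, ht₁.2]) zero_le_one⟩ i j
    simpa [reversedHam] using this
  have hsymm' : ∀ τ, 0 ≤ τ → (reversedHam H t₁ τ).IsSymm := fun τ _ =>
    isSymm_reversedHam hHsymm t₁ τ
  have hcont' := (continuous_reversedHam hHcont t₁).continuousOn (s := Ici 0)
  obtain ⟨hex', hlow'⟩ := hflow' _ hcont' T ((min_le_right _ _).trans (min_le_right _ _)) hBr
  have hmov := fun Z₁ => exists_isGaussianPath hbar0 hc' hcont' hsymm' Matrix.PosDef.one hex'
    hlow' Z₁
  have hae := ae_eq_zero_of_integral_mul_gaussian hbar0 (hV.memLp t₁ ht₁) (fun Z₁ => ?_)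
    fun Z₁ => ?_
  · filter_upwards [hae] with z hz
    exact sub_eq_zero.1 hz
  · obtain ⟨G', Z', β', hp, hG', hZ', hβ'⟩ := hmov Z₁
    have h := hV.integral_mul_gaussian_eq_zero hHcont hHsymm hV0 ht₁ ht₁.2
      (fun s hs => reMat_reversedHam hs.1) (fun s hs => imMat_reversedHam hs.1) hp
    rwa [hG', hZ', hβ'] at h
  · obtain ⟨G', Z', β', hp, hG', hZ', hβ'⟩ := hmov Z₁
    have h := hp.memLp ⟨le_rfl, hT0⟩
    rwa [hG', hZ', hβ'] at h
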